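/- For complex numbers $p$ with $|p|<1$ and $x\neq 0$ let $\theta(x;p)=\prod_{i\ge 0}(1-xp^i)(1-p^{i+1}/x)$ (so $\theta(x;0)=1-x$), and for integers $k\ge 0$ let $(x;q,p)_k=\prod_{i=0}^{k-1}\theta(xq^i;p)$ and $(x_1,\dots,x_r;q,p)_k=(x_1;q,p)_k\cdots(x_r;q,p)_k$. Let $n$ be a non-negative integer and let $a,b,q,p$ be complex numbers with $a,b,q\neq 0$ and $|p|<1$, such that none of the denominators in the following identity vanishes (in the sum on the right-hand side this is only required for the terms with $2k\le n$; the terms with $2k>n$ contain the factor $(q^{-n};q,p)_{2k}=0$ and are read as $0$). Then $$ \sum_{j=0}^{n} \frac{\theta(abq^{4j+1};p^2)\,(b^2q^{2n},q^{-2n},a/bq,abq;q^2,p^2)_j\,(-aq;q,p)_{2j}\,(b^2q^4;q^4,p^2)_j} {\theta(abq;p^2)\,(aq^{3-2n}/b,abq^{3+2n},b^2q^4,q^2;q^2,p^2)_j\,(-bq;q,p)_{2j}\,(a^2q^2;q^4,p^2)_j} (-1)^jq^{3j} $$ $$ =\frac{\theta(-b;p)\,(-q,b/a;q,p)_n\,(abq^3;q^2,p^2)_n}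 {\theta(-bq^{2n};p)\,(-b,aq;q,p)_n\,(b/aq;q^2,p^2)_n}\,q^{-n} \sum_{k=0}^{n} \frac{\theta(a^2q^{8k};p^2)\,(bq^n,q^{-n};q,p)_{2k}\,(a^2,a^2/b^2q^2;q^4,p^2)_k} {\theta(a^2;p^2)\,(aq^{1-n}/b,aq^{1+n};q,p)_{2k}\,(q^4,b^2q^6;q^4,p^2)_k}\,q^{4k}. $$ Here $a/bq$, $b/aq$ and $a^2/b^2q^2$ stand for $a/(bq)$, $b/(aq)$ and $a^2/(b^2q^2)$. -/

import Mathlib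

/-- The infinite `q`-shifted factorial `(a; q)_∞ = ∏_{j ≥ 0} (1 - a q^j)`
(the product converges for `‖q‖ < 1`). -/
noncomputable def qFacInf (a q : ℂ) : ℂ := ∏' j : ℕ, (1 - a * q ^ j)

/-- For `‖q‖ < 1` the product defining `(a; q)_∞` converges. -/
theorem multipliable_qFacInf (a : ℂ) {q : ℂ} (hq : ‖q‖ < 1) :
    Multipliable fun j : ℕ => 1 - a * q ^ j := by
  have h : Summable fun j : ℕ => ‖-(a * q ^ j)‖ := by
    simpa [norm_mul, norm_pow] using
      (summable_geometric_of_lt_one (norm_nonneg q) hq).mul_left ‖a‖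
  simpa [sub_eq_add_neg] using multipliable_one_add_of_summable h

/-- The modified Jacobi theta function `θ(a; p) = (a; p)_∞ (p/a; p)_∞`, for `a ≠ 0`, `‖p‖ < 1`. -/
noncomputable def ellTheta (a p : ℂ) : ℂ := qFacInf a p * qFacInf (p / a) p

/-- The `q, p`-shifted factorial `(a; q, p)_k = ∏_{j=0}^{k-1} θ(a q^j; p)`. -/
noncomputable def ellFac (a q p : ℂ) (k : ℕ) : ℂ :=
  ∏ j ∈ Finset.range k, ellTheta (a * q ^ j) p

/-- The shorthand `(a₁, …, a_r; q, p)_k = (a₁; q, p)_k ⋯ (a_r; q, p)_k`. -/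
noncomputable def ellFacs (as : List ℂ) (q p : ℂ) (k : ℕ) : ℂ :=
  (as.map fun a => ellFac a q p k).prod

/-!
The series on the two sides are terminating sums against the kernels of the elliptic well-poised
Bailey lemma,
`(B)_{n+j} (B/A)_{n-j} / ((Aq)_{n+j} (q)_{n-j})`,
the left-hand side in base `q²` and nome `p²` with `(A, B) = (abq, b²)`, the right-hand side in
base `q` and nome `p` with `(A, B) = (a, b)` and only even columns `2k`
(`baileyKernel_eq_mul_ellFac`). The identity between them comes from three sums of kernels, each of
them a case of the Frenkel–Turaev sum:

* the kernels `(A, B)` and `(B, A)` are inverse to each other up to diagonal factors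
  (`baileyKernel_inversion`, used in base `q²`);
* multiplication by the kernel `(b², abq)` in base `q²` turns the kernel `(a, b)` in base `q` into
  the kernel `(a², abq)` in base `q²` (`sum_baileyKernel_sq_mul_baileyKernel`, summed in base `q`
  with pairs of opposite parameters, since `θ(x²; p²) = θ(x; p) θ(-x; p)`);
* the coefficients of the right-hand side sum against the even columns of that kernel to a product
  (`sum_quarticCoeff_mul_baileyKernel`, in base `q⁴`, with one case for each parity of the row).

The last two say that the kernel `(b², abq)` sends the right-hand side, as a sequence in `n`, to
the coefficients of the left-hand side, and the inversion solves for the right-hand side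
(`sum_baileyKernel_eq_sum_quarticCoeff`).

The Frenkel–Turaev sum (`sum_frenkelTuraevTerm`) follows by induction on its length from
Weierstrass' addition formula (`ellTheta_addition`). By the Jacobi triple product
(`qFacInf_mul_ellTheta`) a product `θ(xy; p) θ(x/y; p)` is a two by two determinant of theta series
in `x` and in `y`, and the addition formula is the Plücker relation between such determinants.

The intermediate steps divide by theta functions that do not occur as denominators in the theorem.
They are nonzero when `a` and `b` are multiplicatively independent modulo `q` and `p`
(`IsGenericPair`). Such pairs are dense, and both sides are continuous in `(a, b)` at every point
where no denominator vanishes, which gives the remaining cases.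
-/

open Filter Topology Finset

/-! ### Infinite shifted factorials -/

theorem summable_norm_mul_pow (a : ℂ) {q : ℂ} (hq : ‖q‖ < 1) :
    Summable fun j : ℕ => ‖-(a * q ^ j)‖ := by
  simpa [norm_mul, norm_pow] using
    (summable_geometric_of_lt_one (norm_nonneg q) hq).mul_left ‖a‖

theorem qFacInf_eq_one_sub_mul (a : ℂ) {p : ℂ} (hp : ‖p‖ < 1) :
    qFacInf a p = (1 - a) * qFacInf (p * a) p := by
  have h := multipliable_qFacInf (p * a) hp
  have e : (fun j : ℕ => 1 - a * p ^ (j + 1)) = fun j => 1 - p * a * p ^ j := by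
    funext j; ring
  unfold qFacInf
  rw [tprod_eq_zero_mul' (by rw [e]; exact h), e]
  simp

theorem exists_pow_eq_of_qFacInf_eq_zero {a p : ℂ} (hp : ‖p‖ < 1) (h : qFacInf a p = 0) :
    ∃ j : ℕ, a * p ^ j = 1 := by
  by_contra! hne
  refine tprod_one_add_ne_zero_of_summable (f := fun j : ℕ => -(a * p ^ j)) (fun j h0 => ?_)
    (summable_norm_mul_pow a hp) (by simpa [qFacInf, sub_eq_add_neg] using h)
  exact hne j (by linear_combination -h0)

theorem qFacInf_sq (a : ℂ) {p : ℂ} (hp : ‖p‖ < 1) :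
    qFacInf (a ^ 2) (p ^ 2) = qFacInf a p * qFacInf (-a) p := by
  unfold qFacInf
  rw [← (multipliable_qFacInf a hp).tprod_mul (multipliable_qFacInf (-a) hp)]
  exact tprod_congr fun j => by ring

theorem continuousAt_qFacInf (a : ℂ) {p : ℂ} (hp : ‖p‖ < 1) :
    ContinuousAt (fun x => qFacInf x p) a := by
  have hb : ∀ᶠ x in 𝓝 a, ‖x‖ ≤ ‖a‖ + 1 :=
    (continuous_norm.tendsto a).eventually_le_const (by linarith)
  have := tendsto_tprod_one_add_of_dominated_convergence (𝓕 := 𝓝 a)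
    (f := fun x (j : ℕ) => -(x * p ^ j)) (g := fun j => -(a * p ^ j))
    (bound := fun j => (‖a‖ + 1) * ‖p‖ ^ j)
    ((summable_geometric_of_lt_one (norm_nonneg p) hp).mul_left _)
    (fun j => (Continuous.tendsto (by fun_prop) a))
    (by
      filter_upwards [hb] with x hx j
      rw [norm_neg, norm_mul, norm_pow]
      gcongr)
  simpa [ContinuousAt, qFacInf, sub_eq_add_neg] using this

/-! ### The modified theta function -/

theorem ellTheta_one (p : ℂ) : ellTheta 1 p = 0 := by
  have : qFacInf 1 p = 0 := by
    refine tprod_of_exists_eq_zero ⟨0, by simp⟩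
  simp [ellTheta, this]

theorem ellTheta_zero_nome (x : ℂ) : ellTheta x 0 = 1 - x := by
  have h (a : ℂ) : qFacInf a 0 = 1 - a := by
    rw [qFacInf_eq_one_sub_mul a (by simp)]
    simp [qFacInf]
  simp [ellTheta, h]

/-- The reflection `θ(1/x; p) = -x⁻¹ θ(x; p)`. -/
theorem ellTheta_inv {x p : ℂ} (hx : x ≠ 0) (hp : ‖p‖ < 1) :
    ellTheta x⁻¹ p = -x⁻¹ * ellTheta x p := by
  have h1 := qFacInf_eq_one_sub_mul x⁻¹ hp
  have h2 := qFacInf_eq_one_sub_mul x hp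
  unfold ellTheta
  rw [h1, h2, div_inv_eq_mul, div_eq_mul_inv]
  field_simp
  ring

theorem ellTheta_sq (x : ℂ) {p : ℂ} (hp : ‖p‖ < 1) :
    ellTheta (x ^ 2) (p ^ 2) = ellTheta x p * ellTheta (-x) p := by
  have h : p ^ 2 / x ^ 2 = (p / x) ^ 2 := by rw [div_pow]
  unfold ellTheta
  rw [h, qFacInf_sq _ hp, qFacInf_sq _ hp, div_neg]
  ring

theorem exists_zpow_eq_of_ellTheta_eq_zero {x p : ℂ} (hp : ‖p‖ < 1) (h : ellTheta x p = 0) :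
    ∃ m : ℤ, x = p ^ m := by
  rcases mul_eq_zero.1 h with h | h
  · obtain ⟨j, hj⟩ := exists_pow_eq_of_qFacInf_eq_zero hp h
    exact ⟨-j, by rw [zpow_neg, zpow_natCast]; exact eq_inv_of_mul_eq_one_left hj⟩
  · obtain ⟨j, hj⟩ := exists_pow_eq_of_qFacInf_eq_zero hp h
    refine ⟨j + 1, ?_⟩
    have hx : x ≠ 0 := by rintro rfl; simp at hj
    field_simp at hj
    rw [← hj]
    norm_cast
    ring

theorem continuousAt_ellTheta {x p : ℂ} (hx : x ≠ 0) (hp : ‖p‖ < 1) :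
    ContinuousAt (fun x => ellTheta x p) x :=
  (continuousAt_qFacInf x hp).mul
    (ContinuousAt.comp (f := fun x => p / x) (continuousAt_qFacInf (p / x) hp)
      (continuousAt_const.div continuousAt_id hx))

/-! ### The Jacobi triple product -/

/-- The triangular number `n (n - 1) / 2` of an integer. -/
def triangular (n : ℤ) : ℤ := n * (n - 1) / 2

theorem two_mul_triangular (n : ℤ) : 2 * triangular n = n * (n - 1) :=
  Int.mul_ediv_cancel' (Int.even_mul_pred_self n).two_dvd

theorem triangular_add_one (n : ℤ) : triangular (n + 1) = triangular n + n := by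
  have h1 := two_mul_triangular n
  have h2 := two_mul_triangular (n + 1)
  have : 2 * triangular (n + 1) = 2 * (triangular n + n) := by rw [h2, mul_add, h1]; ring
  omega

theorem triangular_natCast (k : ℕ) : triangular k = (k.choose 2 : ℕ) := by
  induction k with
  | zero => simp [triangular]
  | succ k ih =>
    rw [Nat.cast_succ, triangular_add_one, ih, Nat.choose_succ_succ' k 1]
    simp [add_comm]

/-- The terms of the Laurent series of the theta function. -/
noncomputable def thetaTerm (p x : ℂ) (n : ℤ) : ℂ := (-1) ^ n * p ^ triangular n * x ^ n

theorem summable_pow_choose_two_mul {r : ℝ} (h0 : 0 < r) (h1 : r < 1) {y : ℝ} (hy : 0 < y) :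
    Summable fun k : ℕ => r ^ k.choose 2 * y ^ k := by
  refine summable_of_ratio_test_tendsto_lt_one (l := 0) one_pos
    (.of_forall fun k => by positivity) ?_
  have : (fun k : ℕ => ‖r ^ (k + 1).choose 2 * y ^ (k + 1)‖ / ‖r ^ k.choose 2 * y ^ k‖)
      = fun k => r ^ k * y := by
    funext k
    rw [Real.norm_of_nonneg (by positivity), Real.norm_of_nonneg (by positivity),
      Nat.choose_succ_succ' k 1]
    simp only [Nat.choose_one_right, Nat.reduceAdd]
    field_simp
    ring
  rw [this]
  simpa using (tendsto_pow_atTop_nhds_zero_of_lt_one h0.le h1).mul_const y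

theorem summable_norm_thetaTerm {p x : ℂ} (hp0 : p ≠ 0) (hp : ‖p‖ < 1) (hx : x ≠ 0) :
    Summable fun n => ‖thetaTerm p x n‖ := by
  have h0 : 0 < ‖p‖ := norm_pos_iff.2 hp0
  have hx0 : 0 < ‖x‖ := norm_pos_iff.2 hx
  refine Summable.of_nat_of_neg ?_ ?_
  · refine (summable_pow_choose_two_mul h0 hp hx0).congr fun k => ?_
    simp [thetaTerm, triangular_natCast]
  · refine (summable_pow_choose_two_mul h0 hp (y := ‖p‖ / ‖x‖) (by positivity)).congr fun k => ?_
    have : triangular (-k) = (k.choose 2 : ℕ) + k := by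
      rw [← triangular_natCast]
      have h1 := two_mul_triangular k
      have h2 := two_mul_triangular (-k)
      have : 2 * triangular (-k) = 2 * (triangular k + k) := by rw [h2, mul_add, h1]; ring
      omega
    rw [thetaTerm, this, zpow_add₀ hp0, zpow_natCast, zpow_natCast, zpow_neg, zpow_natCast]
    simp [div_pow]
    field_simp

/-- The finite product `(p; p)_k`. -/
noncomputable def qFactorial (p : ℂ) (k : ℕ) : ℂ := ∏ i ∈ range k, (1 - p ^ (i + 1))

theorem qFactorial_succ (p : ℂ) (k : ℕ) :
    qFactorial p (k + 1) = qFactorial p k * (1 - p ^ (k + 1)) := prod_range_succ _ _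

theorem one_sub_pow_succ_ne_zero {p : ℂ} (hp : ‖p‖ < 1) (k : ℕ) : 1 - p ^ (k + 1) ≠ 0 := by
  intro h
  have : ‖p ^ (k + 1)‖ = 1 := by rw [← sub_eq_zero.1 h]; simp
  rw [norm_pow] at this
  exact absurd this (pow_lt_one₀ (norm_nonneg p) hp (by simp)).ne

theorem qFactorial_ne_zero {p : ℂ} (hp : ‖p‖ < 1) (k : ℕ) : qFactorial p k ≠ 0 :=
  prod_ne_zero_iff.2 fun i _ => one_sub_pow_succ_ne_zero hp i

theorem qFacInf_self_ne_zero {p : ℂ} (hp : ‖p‖ < 1) : qFacInf p p ≠ 0 := by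
  intro h
  obtain ⟨j, hj⟩ := exists_pow_eq_of_qFacInf_eq_zero hp h
  exact one_sub_pow_succ_ne_zero hp j (by rw [← hj]; ring)

theorem tendsto_qFactorial {p : ℂ} (hp : ‖p‖ < 1) :
    Tendsto (qFactorial p) atTop (𝓝 (qFacInf p p)) := by
  refine (multipliable_qFacInf p hp).hasProd.tendsto_prod_nat.congr fun k => ?_
  exact prod_congr rfl fun i _ => by ring

/-- The `q`-binomial theorem. -/
theorem prod_one_sub_mul_pow {p : ℂ} (hp : ‖p‖ < 1) (z : ℂ) (M : ℕ) :
    ∏ i ∈ range M, (1 - z * p ^ i) = ∑ k ∈ range (M + 1),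
      qFactorial p M / (qFactorial p k * qFactorial p (M - k))
        * ((-1) ^ k * p ^ k.choose 2 * z ^ k) := by
  have h (k) := qFactorial_ne_zero hp k
  induction M with
  | zero => simp [qFactorial]
  | succ M ih =>
    set c : ℕ → ℂ := fun k => qFactorial p M / (qFactorial p k * qFactorial p (M - k))
        * ((-1) ^ k * p ^ k.choose 2 * z ^ k) with hc
    set d : ℕ → ℂ := fun k => qFactorial p (M + 1) / (qFactorial p k * qFactorial p (M + 1 - k))
        * ((-1) ^ k * p ^ k.choose 2 * z ^ k) with hd
    have h0 : d 0 = c 0 := by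
      have e1 := h M
      have e2 := h (M + 1)
      simp only [hc, hd, Nat.sub_zero]
      field_simp
    have h1 : d (M + 1) = -(z * p ^ M) * c M := by
      simp only [hc, hd, Nat.choose_succ_succ' M 1, Nat.sub_self]
      simp only [Nat.choose_one_right, Nat.reduceAdd, pow_add]
      field_simp [h]
    have h2 : ∀ k ∈ range M, d (k + 1) = c (k + 1) + -(z * p ^ M) * c k := by
      intro k hk
      obtain ⟨e, rfl⟩ : ∃ e, M = k + 1 + e := ⟨M - (k + 1), by have := mem_range.1 hk; omega⟩
      simp only [hc, hd, Nat.choose_succ_succ' k 1,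
        show k + 1 + e + 1 - (k + 1) = e + 1 by omega, show k + 1 + e - (k + 1) = e by omega,
        show k + 1 + e - k = e + 1 by omega]
      have e1 := one_sub_pow_succ_ne_zero hp k
      have e2 := one_sub_pow_succ_ne_zero hp e
      have e3 := h k
      have e4 := h e
      rw [qFactorial_succ p (k + 1 + e), qFactorial_succ p k, qFactorial_succ p e]
      simp only [Nat.choose_one_right, Nat.reduceAdd]
      field_simp
      ring
    rw [prod_range_succ, ih, sum_range_succ' d, sum_range_succ (fun k => d (k + 1)), h0, h1,
      sum_congr rfl h2, sum_add_distrib, ← mul_sum, mul_sub, mul_one]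
    have e1 := sum_range_succ' c M
    have e2 := sum_range_succ c M
    linear_combination e1 - (z * p ^ M) * e2

theorem prod_theta_factors {p x : ℂ} (hp0 : p ≠ 0) (hp : ‖p‖ < 1) (hx : x ≠ 0) (N : ℕ) :
    (∏ t ∈ range N, (1 - x * p ^ t)) * ∏ t ∈ range N, (1 - p / x * p ^ t)
      = ∑ k ∈ range (N + N + 1),
        qFactorial p (N + N) / (qFactorial p k * qFactorial p (N + N - k))
          * thetaTerm p x (k - N) := by
  have h1 : ∏ t ∈ range N, (1 - p / x * p ^ t)
      = (∏ i ∈ range N, (1 - x * p ^ (-(N : ℤ)) * p ^ i))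
        * ((-1) ^ (N : ℤ) * p ^ triangular (N + 1) * x ^ (-(N : ℤ))) := by
    have hC : ((-1) ^ (N : ℤ) * p ^ triangular (N + 1) * x ^ (-(N : ℤ)))
        = ∏ t ∈ range N, (-(p ^ (t + 1) / x)) := by
      induction N with
      | zero => simp [triangular]
      | succ N ih =>
        rw [prod_range_succ, ← ih, triangular_add_one ((N + 1 : ℕ) : ℤ), zpow_add₀ hp0]
        push_cast
        rw [neg_add, zpow_add₀ hx, zpow_add₀ (by norm_num : (-1 : ℂ) ≠ 0)]
        norm_cast
        simp
        field_simp
    rw [hC, ← prod_range_reflect (fun i => 1 - x * p ^ (-(N : ℤ)) * p ^ i), ← prod_mul_distrib]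
    refine prod_congr rfl fun t ht => ?_
    obtain ⟨e, rfl⟩ : ∃ e, N = t + 1 + e := ⟨N - (t + 1), by have := mem_range.1 ht; omega⟩
    rw [show t + 1 + e - 1 - t = e by omega, zpow_neg, zpow_natCast]
    field_simp
    ring
  have h2 : ∏ t ∈ range N, (1 - x * p ^ t)
      = ∏ i ∈ range N, (1 - x * p ^ (-(N : ℤ)) * p ^ (N + i)) := by
    refine prod_congr rfl fun t _ => ?_
    rw [pow_add, zpow_neg, zpow_natCast]
    field_simp
  rw [h1, h2, ← mul_assoc, mul_comm (∏ i ∈ range N, _) (∏ i ∈ range N, _),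
    ← prod_range_add (fun i => 1 - x * p ^ (-(N : ℤ)) * p ^ i), prod_one_sub_mul_pow hp, sum_mul]
  refine sum_congr rfl fun k _ => ?_
  rw [mul_assoc]
  congr 1
  have e : triangular (k - N) = (k.choose 2 : ℕ) + -(N * k : ℤ) + triangular (N + 1) := by
    rw [← triangular_natCast]
    have h1 := two_mul_triangular k
    have h2 := two_mul_triangular (k - N)
    have h3 := two_mul_triangular (N + 1)
    have : 2 * triangular (k - N) = 2 * (triangular k + -(N * k) + triangular (N + 1)) := by
      linear_combination h2 - h1 - h3
    omega
  rw [thetaTerm, e, zpow_add₀ hp0, zpow_add₀ hp0, sub_eq_add_neg, zpow_add₀ hx,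
    zpow_add₀ (by norm_num : (-1 : ℂ) ≠ 0), mul_pow, ← zpow_natCast (p ^ (-(N : ℤ))), ← zpow_mul,
    neg_mul]
  have : (-1 : ℂ) ^ (-(N : ℤ)) = (-1) ^ (N : ℤ) := by
    rw [zpow_neg, ← inv_zpow, inv_neg_one]
  rw [this]
  simp only [zpow_natCast]
  ring

/-- The Jacobi triple product identity. -/
theorem qFacInf_mul_ellTheta {p x : ℂ} (hp0 : p ≠ 0) (hp : ‖p‖ < 1) (hx : x ≠ 0) :
    qFacInf p p * ellTheta x p = ∑' n, thetaTerm p x n := by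
  have hP := qFacInf_self_ne_zero hp
  have hlim := tendsto_qFactorial hp
  have hlim' := hlim.inv₀ hP
  obtain ⟨C, hC⟩ := hlim.norm.bddAbove_range
  obtain ⟨C', hC'⟩ := hlim'.norm.bddAbove_range
  replace hC (k) : ‖qFactorial p k‖ ≤ C := hC ⟨k, rfl⟩
  replace hC' (k) : ‖(qFactorial p k)⁻¹‖ ≤ C' := hC' ⟨k, rfl⟩
  have hC0 : 0 ≤ C := (norm_nonneg _).trans (hC 0)
  have hC0' : 0 ≤ C' := (norm_nonneg _).trans (hC' 0)
  set f : ℕ → ℤ → ℂ := fun N n => if -(N : ℤ) ≤ n ∧ n ≤ N then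
    qFactorial p (N + N) * (qFactorial p (n + N).toNat)⁻¹ * (qFactorial p (N - n).toNat)⁻¹
      * thetaTerm p x n else 0 with hf
  have hsum (N : ℕ) : ∑' n, f N n
      = (∏ t ∈ range N, (1 - x * p ^ t)) * ∏ t ∈ range N, (1 - p / x * p ^ t) := by
    rw [prod_theta_factors hp0 hp hx]
    have hinj : Function.Injective fun k : ℕ => (k : ℤ) - N := fun a b h => by
      simp only at h; omega
    rw [tsum_eq_sum (s := (range (N + N + 1)).map ⟨_, hinj⟩), sum_map]
    · refine sum_congr rfl fun k hk => ?_
      have := mem_range.1 hk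
      simp only [hf, Function.Embedding.coeFn_mk]
      rw [if_pos (by omega), show ((k : ℤ) - N + N).toNat = k by omega,
        show ((N : ℤ) - (k - N)).toNat = N + N - k by omega]
      field_simp
    · intro n hn
      simp only [hf]
      refine if_neg fun h => hn ?_
      simp only [Finset.mem_map, mem_range, Function.Embedding.coeFn_mk]
      exact ⟨(n + N).toNat, by omega, by omega⟩
  have h1 : Tendsto (fun N => ∑' n, f N n) atTop (𝓝 (ellTheta x p)) := by
    simp_rw [hsum]
    exact (multipliable_qFacInf x hp).hasProd.tendsto_prod_nat.mul
      (multipliable_qFacInf (p / x) hp).hasProd.tendsto_prod_nat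
  have h2 : Tendsto (fun N => ∑' n, f N n) atTop
      (𝓝 (∑' n, (qFacInf p p)⁻¹ * thetaTerm p x n)) := by
    refine tendsto_tsum_of_dominated_convergence
      (bound := fun n => C * C' * C' * ‖thetaTerm p x n‖)
      ((summable_norm_thetaTerm hp0 hp hx).mul_left _) (fun n => ?_) (.of_forall fun N n => ?_)
    · have t1 : Tendsto (fun N : ℕ => N + N) atTop atTop :=
        tendsto_atTop_mono (fun N => Nat.le_add_left N N) tendsto_id
      have t2 : Tendsto (fun N : ℕ => (n + N).toNat) atTop atTop :=
        tendsto_atTop_atTop.2 fun b => ⟨b + n.natAbs, fun a ha => by omega⟩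
      have t3 : Tendsto (fun N : ℕ => ((N : ℤ) - n).toNat) atTop atTop :=
        tendsto_atTop_atTop.2 fun b => ⟨b + n.natAbs, fun a ha => by omega⟩
      have t := (((hlim.comp t1).mul (hlim'.comp t2)).mul (hlim'.comp t3)).mul_const
        (thetaTerm p x n)
      rw [mul_inv_cancel₀ hP, one_mul] at t
      refine t.congr' ?_
      filter_upwards [eventually_ge_atTop n.natAbs] with N hN
      simp only [hf]
      rw [if_pos (by omega)]
      rfl
    · simp only [hf]
      split_ifs
      · rw [norm_mul, norm_mul, norm_mul]
        gcongr
        exacts [hC _, hC' _, hC' _]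
      · rw [norm_zero]; positivity
  rw [tendsto_nhds_unique h1 h2, tsum_mul_left, mul_inv_cancel_left₀ hP]

/-! ### The addition formula -/

/-- The theta series `∑ p^{n²} x^{2n}`. -/
noncomputable def thetaEven (p x : ℂ) : ℂ := ∑' n : ℤ, p ^ (n * n) * x ^ (2 * n)

/-- The theta series `∑ p^{n² + n} x^{2n + 1}`. -/
noncomputable def thetaOdd (p x : ℂ) : ℂ := ∑' n : ℤ, p ^ (n * n + n) * x ^ (2 * n + 1)

theorem summable_norm_thetaEven {p x : ℂ} (hp0 : p ≠ 0) (hp : ‖p‖ < 1) (hx : x ≠ 0) :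
    Summable fun n : ℤ => ‖p ^ (n * n) * x ^ (2 * n)‖ := by
  have hp2 : ‖p ^ 2‖ < 1 := by rw [norm_pow]; exact pow_lt_one₀ (norm_nonneg _) hp two_ne_zero
  refine (summable_norm_thetaTerm (pow_ne_zero 2 hp0) hp2
    (mul_ne_zero hp0 (pow_ne_zero 2 hx))).congr fun n => ?_
  rw [thetaTerm, norm_mul, norm_mul, norm_zpow, norm_neg, norm_one, one_zpow, one_mul, ← norm_mul,
    mul_zpow, ← zpow_natCast p 2, ← zpow_natCast x 2, ← zpow_mul, ← zpow_mul, ← mul_assoc,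
    ← zpow_add₀ hp0]
  congr 3
  have := two_mul_triangular n
  push_cast
  rw [this]; ring

theorem summable_norm_thetaOdd {p x : ℂ} (hp0 : p ≠ 0) (hp : ‖p‖ < 1) (hx : x ≠ 0) :
    Summable fun n : ℤ => ‖p ^ (n * n + n) * x ^ (2 * n + 1)‖ := by
  have hp2 : ‖p ^ 2‖ < 1 := by rw [norm_pow]; exact pow_lt_one₀ (norm_nonneg _) hp two_ne_zero
  refine ((summable_norm_thetaTerm (pow_ne_zero 2 hp0) hp2
    (mul_ne_zero (pow_ne_zero 2 hp0) (pow_ne_zero 2 hx))).mul_right ‖x‖).congr fun n => ?_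
  rw [thetaTerm, norm_mul, norm_mul, norm_zpow, norm_neg, norm_one, one_zpow, one_mul, ← norm_mul,
    ← norm_mul,
    mul_zpow, ← zpow_natCast p 2, ← zpow_natCast x 2, ← zpow_mul, ← zpow_mul, ← zpow_mul, ← mul_assoc,
    ← zpow_add₀ hp0, zpow_add₀ hx, zpow_one, mul_assoc]
  congr 3
  have := two_mul_triangular n
  push_cast
  rw [this]; ring

/-- The product of the thetas at `x y` and `x / y` is a two by two determinant: in the double
series, the terms are sorted by the parity of the sum of the two indices. -/
theorem ellTheta_mul_ellTheta {p x y : ℂ} (hp0 : p ≠ 0) (hp : ‖p‖ < 1) (hx : x ≠ 0) (hy : y ≠ 0) :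
    qFacInf p p ^ 2 * (ellTheta (x * y) p * ellTheta (x / y) p)
      = x * (thetaOdd p x * thetaEven p y - thetaEven p x * thetaOdd p y) := by
  have s1 := summable_norm_thetaTerm hp0 hp (mul_ne_zero hx hy)
  have s2 := summable_norm_thetaTerm hp0 hp (div_ne_zero hx hy)
  set F : ℤ × ℤ → ℂ := fun z => thetaTerm p (x * y) z.1 * thetaTerm p (x / y) z.2 with hF
  have hFs : Summable F := summable_mul_of_summable_norm s1 s2
  set e₀ : ℤ × ℤ → ℤ × ℤ := fun z => (z.1 + 1 + z.2, z.1 + 1 - z.2) with he₀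
  set e₁ : ℤ × ℤ → ℤ × ℤ := fun z => (z.1 + z.2 + 1, z.1 - z.2) with he₁
  have i₀ : Function.Injective e₀ := fun a b h => by
    simp only [he₀, Prod.mk.injEq] at h
    ext <;> omega
  have i₁ : Function.Injective e₁ := fun a b h => by
    simp only [he₁, Prod.mk.injEq] at h
    ext <;> omega
  have hc : IsCompl (Set.range e₀) (Set.range e₁) := by
    rw [← compl_eq_iff_isCompl]
    ext ⟨m, n⟩
    simp only [Set.mem_compl_iff, Set.mem_range, Prod.exists, he₀, he₁, Prod.mk.injEq]
    constructor
    · intro h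
      by_contra h'
      rcases Int.even_or_odd' (m + n) with ⟨k, hk | hk⟩
      · exact h ⟨k - 1, m - k, by omega, by omega⟩
      · exact h' ⟨k, m - k - 1, by omega, by omega⟩
    · rintro ⟨a, b, h1, h2⟩ ⟨c, d, h3, h4⟩
      omega
  have hsplit : ∑' z, F z = ∑' z, F (e₀ z) + ∑' z, F (e₁ z) := by
    have h0 : HasSum (F ∘ ((↑) : Set.range e₀ → ℤ × ℤ)) (∑' z, F (e₀ z)) :=
      (Function.Injective.hasSum_range_iff i₀ (f := F)).2 (hFs.comp_injective i₀).hasSum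
    have h1 : HasSum (F ∘ ((↑) : Set.range e₁ → ℤ × ℤ)) (∑' z, F (e₁ z)) :=
      (Function.Injective.hasSum_range_iff i₁ (f := F)).2 (hFs.comp_injective i₁).hasSum
    exact (h0.add_isCompl hc h1).tsum_eq
  have hF0 (z : ℤ × ℤ) : F (e₀ z)
      = x * ((p ^ (z.1 * z.1 + z.1) * x ^ (2 * z.1 + 1)) * (p ^ (z.2 * z.2) * y ^ (2 * z.2))) := by
    obtain ⟨a, b⟩ := z
    have t : triangular (a + 1 + b) + triangular (a + 1 - b) = a * a + a + b * b := by
      have h1 := two_mul_triangular (a + 1 + b)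
      have h2 := two_mul_triangular (a + 1 - b)
      have : 2 * (triangular (a + 1 + b) + triangular (a + 1 - b)) = 2 * (a * a + a + b * b) := by
        rw [mul_add, h1, h2]; ring
      omega
    have hs : (-1 : ℂ) ^ (a + 1 + b) * (-1) ^ (a + 1 - b) = 1 := by
      rw [← zpow_add₀ (by norm_num), show a + 1 + b + (a + 1 - b) = 2 * (a + 1) by ring, zpow_mul]
      simp
    have hxx : x ^ (a + 1 + b) * x ^ (a + 1 - b) = x * x ^ (2 * a + 1) := by
      rw [← zpow_add₀ hx, ← zpow_one_add₀ hx]; congr 1; ring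
    have hyy : y ^ (a + 1 + b) / y ^ (a + 1 - b) = y ^ (2 * b) := by
      rw [← zpow_sub₀ hy]; congr 1; ring
    have hpp : p ^ triangular (a + 1 + b) * p ^ triangular (a + 1 - b)
        = p ^ (a * a + a) * p ^ (b * b) := by
      rw [← zpow_add₀ hp0, ← zpow_add₀ hp0, t]
    simp only [hF, he₀, thetaTerm, mul_zpow, div_zpow]
    calc _ = ((-1 : ℂ) ^ (a + 1 + b) * (-1) ^ (a + 1 - b))
          * (p ^ triangular (a + 1 + b) * p ^ triangular (a + 1 - b))
          * (x ^ (a + 1 + b) * x ^ (a + 1 - b)) * (y ^ (a + 1 + b) / y ^ (a + 1 - b)) := by ring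
      _ = _ := by rw [hs, hpp, hxx, hyy]; ring
  have hF1 (z : ℤ × ℤ) : F (e₁ z)
      = -x * ((p ^ (z.1 * z.1) * x ^ (2 * z.1))
        * (p ^ (z.2 * z.2 + z.2) * y ^ (2 * z.2 + 1))) := by
    obtain ⟨a, b⟩ := z
    have t : triangular (a + b + 1) + triangular (a - b) = a * a + (b * b + b) := by
      have h1 := two_mul_triangular (a + b + 1)
      have h2 := two_mul_triangular (a - b)
      have : 2 * (triangular (a + b + 1) + triangular (a - b)) = 2 * (a * a + (b * b + b)) := by
        rw [mul_add, h1, h2]; ring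
      omega
    have hs : (-1 : ℂ) ^ (a + b + 1) * (-1) ^ (a - b) = -1 := by
      rw [← zpow_add₀ (by norm_num), show a + b + 1 + (a - b) = 2 * a + 1 by ring,
        zpow_add₀ (by norm_num), zpow_mul]
      simp
    have hxx : x ^ (a + b + 1) * x ^ (a - b) = x * x ^ (2 * a) := by
      rw [← zpow_add₀ hx, ← zpow_one_add₀ hx]; congr 1; ring
    have hyy : y ^ (a + b + 1) / y ^ (a - b) = y ^ (2 * b + 1) := by
      rw [← zpow_sub₀ hy]; congr 1; ring
    have hpp : p ^ triangular (a + b + 1) * p ^ triangular (a - b)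
        = p ^ (a * a) * p ^ (b * b + b) := by
      rw [← zpow_add₀ hp0, ← zpow_add₀ hp0, t]
    simp only [hF, he₁, thetaTerm, mul_zpow, div_zpow]
    calc _ = ((-1 : ℂ) ^ (a + b + 1) * (-1) ^ (a - b))
          * (p ^ triangular (a + b + 1) * p ^ triangular (a - b))
          * (x ^ (a + b + 1) * x ^ (a - b)) * (y ^ (a + b + 1) / y ^ (a - b)) := by ring
      _ = _ := by rw [hs, hpp, hxx, hyy]; ring
  calc _ = (qFacInf p p * ellTheta (x * y) p) * (qFacInf p p * ellTheta (x / y) p) := by ring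
    _ = ∑' z, F z := by
      rw [qFacInf_mul_ellTheta hp0 hp (mul_ne_zero hx hy),
        qFacInf_mul_ellTheta hp0 hp (div_ne_zero hx hy), tsum_mul_tsum_of_summable_norm s1 s2]
    _ = _ := by
      rw [hsplit]
      simp_rw [hF0, hF1]
      rw [tsum_mul_left, tsum_mul_left,
        ← tsum_mul_tsum_of_summable_norm (summable_norm_thetaOdd hp0 hp hx)
          (summable_norm_thetaEven hp0 hp hy),
        ← tsum_mul_tsum_of_summable_norm (summable_norm_thetaEven hp0 hp hx)
          (summable_norm_thetaOdd hp0 hp hy)]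
      unfold thetaOdd thetaEven
      ring

/-- Weierstrass' addition formula: the Plücker relation between the determinants of
`ellTheta_mul_ellTheta`. -/
theorem ellTheta_addition {p x y u v : ℂ} (hp : ‖p‖ < 1) (hx : x ≠ 0) (hy : y ≠ 0) (hu : u ≠ 0)
    (hv : v ≠ 0) :
    ellTheta (x * y) p * ellTheta (x / y) p * (ellTheta (u * v) p * ellTheta (u / v) p)
      - ellTheta (x * v) p * ellTheta (x / v) p * (ellTheta (u * y) p * ellTheta (u / y) p)
    = u / y * (ellTheta (y * v) p * ellTheta (y / v) p)
        * (ellTheta (x * u) p * ellTheta (x / u) p) := by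
  rcases eq_or_ne p 0 with rfl | hp0
  · simp only [ellTheta_zero_nome]
    field_simp
    ring
  · have h1 := ellTheta_mul_ellTheta hp0 hp hx hy
    have h2 := ellTheta_mul_ellTheta hp0 hp hu hv
    have h3 := ellTheta_mul_ellTheta hp0 hp hx hv
    have h4 := ellTheta_mul_ellTheta hp0 hp hu hy
    have h5 := ellTheta_mul_ellTheta hp0 hp hy hv
    have h6 := ellTheta_mul_ellTheta hp0 hp hx hu
    have hP : qFacInf p p ^ 2 * qFacInf p p ^ 2 ≠ 0 := by
      have := qFacInf_self_ne_zero hp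
      positivity
    refine mul_left_cancel₀ hP ?_
    set P := qFacInf p p ^ 2
    calc _ = (P * (ellTheta (x * y) p * ellTheta (x / y) p))
            * (P * (ellTheta (u * v) p * ellTheta (u / v) p))
          - (P * (ellTheta (x * v) p * ellTheta (x / v) p))
            * (P * (ellTheta (u * y) p * ellTheta (u / y) p)) := by ring
      _ = u / y * (P * (ellTheta (y * v) p * ellTheta (y / v) p))
            * (P * (ellTheta (x * u) p * ellTheta (x / u) p)) := by
          rw [h1, h2, h3, h4, h5, h6]
          field_simp
          ring
      _ = _ := by ring

/-! ### Elliptic shifted factorials -/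

theorem ellFac_zero (x q p : ℂ) : ellFac x q p 0 = 1 := prod_range_zero _

theorem ellFac_succ (x q p : ℂ) (k : ℕ) :
    ellFac x q p (k + 1) = ellFac x q p k * ellTheta (x * q ^ k) p := prod_range_succ _ _

theorem ellFac_succ' (x q p : ℂ) (k : ℕ) :
    ellFac x q p (k + 1) = ellTheta x p * ellFac (x * q) q p k := by
  rw [ellFac, prod_range_succ', mul_comm]
  simp only [pow_zero, mul_one]
  congr 1
  exact prod_congr rfl fun i _ => by ring_nf

theorem ellFac_add (x q p : ℂ) (m n : ℕ) :
    ellFac x q p (m + n) = ellFac x q p m * ellFac (x * q ^ m) q p n := by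
  rw [ellFac, prod_range_add]
  congr 1
  exact prod_congr rfl fun i _ => by ring_nf

theorem ellFac_two_mul (x q p : ℂ) (k : ℕ) :
    ellFac x q p (2 * k) = ellFac x (q ^ 2) p k * ellFac (x * q) (q ^ 2) p k := by
  induction k with
  | zero => simp [ellFac_zero]
  | succ k ih =>
    rw [mul_add, mul_one, ellFac_succ, ellFac_succ, ellFac_succ, ellFac_succ, ih,
      show x * q * (q ^ 2) ^ k = x * q ^ (2 * k + 1) by ring,
      show x * (q ^ 2) ^ k = x * q ^ (2 * k) by ring]
    ring

theorem ellFac_sq (x q : ℂ) {p : ℂ} (hp : ‖p‖ < 1) (k : ℕ) :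
    ellFac (x ^ 2) (q ^ 2) (p ^ 2) k = ellFac x q p k * ellFac (-x) q p k := by
  simp only [ellFac]
  rw [← prod_mul_distrib]
  refine prod_congr rfl fun i _ => ?_
  rw [neg_mul, ← ellTheta_sq _ hp]
  ring_nf

theorem ellFac_ne_zero {x q p : ℂ} {k : ℕ} (h : ∀ i < k, ellTheta (x * q ^ i) p ≠ 0) :
    ellFac x q p k ≠ 0 :=
  prod_ne_zero_iff.2 fun i hi => h i (mem_range.1 hi)

/-- Reversal of the order of the factors, with `θ(1/x; p) = -x⁻¹ θ(x; p)`. -/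
theorem ellFac_reverse {m q p : ℂ} (hp : ‖p‖ < 1) (hm : m ≠ 0) (hq : q ≠ 0) (i e : ℕ) :
    ellFac ((m * q ^ (i + e))⁻¹ * q) q p i * ellFac m q p e
      * ∏ t ∈ range i, (-(m * q ^ (e + t))) = ellFac m q p (i + e) := by
  induction i generalizing e with
  | zero => simp [ellFac_zero]
  | succ i ih =>
    have h := ih (e + 1)
    rw [show i + (e + 1) = i + 1 + e by ring, ellFac_succ m] at h
    have hx : (m * q ^ (i + 1 + e))⁻¹ * q * q ^ i = (m * q ^ e)⁻¹ := by field_simp; ring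
    rw [ellFac_succ, hx, ellTheta_inv (by positivity) hp, prod_range_succ', ← h]
    simp only [add_assoc, add_comm 1, add_zero]
    field_simp

/-! ### The Frenkel–Turaev sum -/

theorem div_eq_div_add_of_sub_eq {x y x' y' r k : ℂ} (hy : y ≠ 0) (hy' : y' ≠ 0)
    (h : x * y' - x' * y = r * k) : x / y = x' / y' + r / y' * (k / y) := by
  field_simp
  linear_combination h

/-- Reinserts a cancelled factor `t`, so that an identity of quotients which needs `t ≠ 0` can be left
to `ring`. -/
theorem eq_of_eq_mul_mul_inv {x y t : ℂ} (ht : t ≠ 0) (h : x = y * (t * t⁻¹)) : x = y := by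
  rw [h, mul_inv_cancel₀ ht, mul_one]

/-- The terms of the Frenkel–Turaev sum. The parameters are meant to satisfy
`B = a q / b`, `C = a q / c`, `D = a q / d`, `L = a l q` and `a = b c d l`; they are kept
separate in order to have a simple behaviour under `a ↦ a q²`. -/
noncomputable def frenkelTuraevTerm (q p a b c d B C D L l : ℂ) (n i : ℕ) : ℂ :=
  ellTheta (a * q ^ (2 * i)) p
    * (ellFac a q p i * ellFac b q p i * ellFac c q p i * ellFac d q p i)
    / (ellFac q q p i * ellFac B q p i * ellFac C q p i * ellFac D q p i)
    * (ellFac L q p (n + i) * ellFac (l * q) q p (n - i)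
      / (ellFac (a * q) q p (n + i) * ellFac q q p (n - i))) * (l * q) ^ i

theorem frenkelTuraevTerm_succ_left {q p a : ℂ} (b c d B C D L l : ℂ) {n i : ℕ} (hi : i ≤ n) :
    frenkelTuraevTerm q p a b c d B C D L l (n + 1) i
      = frenkelTuraevTerm q p a b c d B C D L l n i
        * (ellTheta (L * q ^ (n + i)) p * ellTheta (l * q * q ^ (n - i)) p
          / (ellTheta (a * q * q ^ (n + i)) p * ellTheta (q * q ^ (n - i)) p)) := by
  unfold frenkelTuraevTerm
  rw [show n + 1 + i = n + i + 1 by omega, show n + 1 - i = n - i + 1 by omega]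
  simp only [ellFac_succ]
  ring

theorem frenkelTuraevTerm_shift {q p a : ℂ} (b c d B C D L l : ℂ) {i e : ℕ} (hq : q ≠ 0)
    (h1 : ellTheta (a * q) p ≠ 0) (h3 : ellTheta (q * q ^ i) p ≠ 0) :
    frenkelTuraevTerm q p a b c d B C D L l (i + e + 1) (i + 1)
        * (ellTheta (a * q ^ (i + 1)) p * ellTheta (q * q ^ i) p * ellTheta l p
          / (ellTheta (a * q * q ^ (i + e + 1 + (i + 1))) p * ellTheta (q * q ^ e) p))
      = frenkelTuraevTerm q p (a * q ^ 2) (b * q) (c * q) (d * q) (B * q) (C * q) (D * q) (L * q)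
          (l / q) (i + e + 1) i
        * (ellTheta L p * ellTheta a p * ellTheta b p * ellTheta c p * ellTheta d p
            / (ellTheta (a * q ^ 2) p * ellTheta B p * ellTheta C p * ellTheta D p)
            * (l * q ^ (i + 1))) := by
  have e1 : ellFac L q p (i + e + 1 + (i + 1))
      = ellTheta L p * ellFac (L * q) q p (i + e + 1 + i) := ellFac_succ' _ _ _ _
  have e2 : ellFac l q p (e + 1) = ellTheta l p * ellFac (l * q) q p e := ellFac_succ' _ _ _ _
  have e3 : ellFac (a * q) q p (i + e + 1 + (i + 1))
        * ellTheta (a * q * q ^ (i + e + 1 + (i + 1))) p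
      = ellTheta (a * q) p * (ellTheta (a * q ^ 2) p
        * ellFac (a * q ^ 2 * q) q p (i + e + 1 + i)) := by
    rw [← ellFac_succ, ellFac_succ', ← add_assoc, ellFac_succ', show a * q * q = a * q ^ 2 by ring]
  have e4 : ellFac a q p (i + 1) * ellTheta (a * q ^ (i + 1)) p
      = ellTheta a p * (ellTheta (a * q) p * ellFac (a * q ^ 2) q p i) := by
    rw [← ellFac_succ, ellFac_succ', ellFac_succ', show a * q * q = a * q ^ 2 by ring]
  have e5 : a * q ^ (2 * (i + 1)) = a * q ^ 2 * q ^ (2 * i) := by ring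
  unfold frenkelTuraevTerm
  rw [show i + e + 1 - (i + 1) = e by omega, show i + e + 1 - i = e + 1 by omega,
    div_mul_cancel₀ l hq, e1, e2, e5, ellFac_succ' b, ellFac_succ' c, ellFac_succ' d,
    ellFac_succ' B, ellFac_succ' C, ellFac_succ' D, ellFac_succ q q p i, ellFac_succ q q p e]
  calc _ = ellTheta (a * q ^ 2 * q ^ (2 * i)) p
          * ((ellFac a q p (i + 1) * ellTheta (a * q ^ (i + 1)) p)
            * (ellTheta b p * ellFac (b * q) q p i)
            * (ellTheta c p * ellFac (c * q) q p i) * (ellTheta d p * ellFac (d * q) q p i))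
        / (ellFac q q p i * (ellTheta B p * ellFac (B * q) q p i)
            * (ellTheta C p * ellFac (C * q) q p i) * (ellTheta D p * ellFac (D * q) q p i))
        * (ellTheta L p * ellFac (L * q) q p (i + e + 1 + i) * (ellTheta l p * ellFac (l * q) q p e)
          / ((ellFac (a * q) q p (i + e + 1 + (i + 1))
            * ellTheta (a * q * q ^ (i + e + 1 + (i + 1))) p) *
            (ellFac q q p e * ellTheta (q * q ^ e) p))) * (l * q) ^ (i + 1)
          * (ellTheta (q * q ^ i) p / ellTheta (q * q ^ i) p) := by ring
    _ = _ := by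
      rw [e3, e4, div_self h3]
      refine eq_of_eq_mul_mul_inv h1 ?_
      ring

/-- The addition formula in a form without square roots. -/
theorem ellTheta_addition' {p a l y z : ℂ} (hp : ‖p‖ < 1) (ha : a ≠ 0) (hl : l ≠ 0) (hy : y ≠ 0)
    (hz : z ≠ 0) :
    ellTheta (a * l * z * y) p * ellTheta (l * z / y) p * (ellTheta (a * z) p * ellTheta z p)
      - ellTheta (a * l * z) p * ellTheta (l * z) p
        * (ellTheta (a * z * y) p * ellTheta (z / y) p)
    = z / y * (ellTheta (a * y) p * ellTheta y p)
        * (ellTheta (a * l * z ^ 2) p * ellTheta l p) := by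
  obtain ⟨s, rfl⟩ : ∃ s, a = s ^ 2 := ⟨_, (IsAlgClosed.exists_pow_nat_eq a two_pos).choose_spec.symm⟩
  have hs : s ≠ 0 := by rintro rfl; simp at ha
  have h := ellTheta_addition hp (x := l * z * s) (y := s * y) (u := z * s) (v := s)
    (by positivity) (by positivity) (by positivity) hs
  rw [show l * z * s * (s * y) = s ^ 2 * l * z * y by ring,
    show l * z * s / (s * y) = l * z / y by field_simp, show z * s * s = s ^ 2 * z by ring,
    show z * s / s = z by field_simp, show l * z * s * s = s ^ 2 * l * z by ring,
    show l * z * s / s = l * z by field_simp, show z * s * (s * y) = s ^ 2 * z * y by ring,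
    show z * s / (s * y) = z / y by field_simp, show s * y * s = s ^ 2 * y by ring,
    show s * y / s = y by field_simp, show l * z * s * (z * s) = s ^ 2 * l * z ^ 2 by ring,
    show l * z * s / (z * s) = l by field_simp] at h
  exact h

/-- Increasing the length of the sum: the term is a combination of a term of the same series and of a
term of the series with `a, b, c, d` replaced by `a q², b q, c q, d q`, with coefficients that do not
depend on the index of summation. -/
theorem frenkelTuraevTerm_recurrence {q p a : ℂ} (b c d B C D : ℂ) {L l : ℂ} {i e : ℕ}
    (hp : ‖p‖ < 1) (ha : a ≠ 0) (hl : l ≠ 0) (hq : q ≠ 0) (hL : L = a * l * q)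
    (h1 : ellTheta (a * q) p ≠ 0) (h3 : ellTheta (q * q ^ i) p ≠ 0)
    (h4 : ellTheta (a * q * q ^ (i + e + 1)) p ≠ 0) (h5 : ellTheta (q * q ^ (i + e + 1)) p ≠ 0)
    (h6 : ellTheta (a * q * q ^ (i + e + 1 + (i + 1))) p ≠ 0) (h7 : ellTheta (q * q ^ e) p ≠ 0) :
    frenkelTuraevTerm q p a b c d B C D L l (i + e + 1 + 1) (i + 1)
      = ellTheta (L * q ^ (i + e + 1)) p * ellTheta (l * q * q ^ (i + e + 1)) p
          / (ellTheta (a * q * q ^ (i + e + 1)) p * ellTheta (q * q ^ (i + e + 1)) p)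
        * frenkelTuraevTerm q p a b c d B C D L l (i + e + 1) (i + 1)
      + l * q * q ^ (i + e + 1) * ellTheta L p * ellTheta (L * q ^ (2 * (i + e + 1) + 1)) p
          * ellTheta a p * ellTheta b p * ellTheta c p * ellTheta d p
          / (ellTheta (a * q * q ^ (i + e + 1)) p * ellTheta (q * q ^ (i + e + 1)) p
            * ellTheta (a * q ^ 2) p * ellTheta B p * ellTheta C p * ellTheta D p)
        * frenkelTuraevTerm q p (a * q ^ 2) (b * q) (c * q) (d * q) (B * q) (C * q) (D * q) (L * q)
          (l / q) (i + e + 1) i := by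
  have hs := frenkelTuraevTerm_shift (e := e) b c d B C D L l hq h1 h3
  rw [frenkelTuraevTerm_succ_left _ _ _ _ _ _ _ _ (by omega),
    show i + e + 1 - (i + 1) = e by omega]
  have hadd := ellTheta_addition' hp ha hl (y := q ^ (i + 1)) (z := q * q ^ (i + e + 1))
    (by positivity) (by positivity)
  rw [show a * l * (q * q ^ (i + e + 1)) * q ^ (i + 1) = L * q ^ (i + e + 1 + (i + 1)) by
      rw [hL]; ring,
    show l * (q * q ^ (i + e + 1)) / q ^ (i + 1) = l * q * q ^ e by field_simp; ring,
    show a * (q * q ^ (i + e + 1)) = a * q * q ^ (i + e + 1) by ring,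
    show a * l * (q * q ^ (i + e + 1)) = L * q ^ (i + e + 1) by rw [hL]; ring,
    show l * (q * q ^ (i + e + 1)) = l * q * q ^ (i + e + 1) by ring,
    show a * q * q ^ (i + e + 1) * q ^ (i + 1) = a * q * q ^ (i + e + 1 + (i + 1)) by ring,
    show q * q ^ (i + e + 1) / q ^ (i + 1) = q * q ^ e by field_simp; ring,
    show a * l * (q * q ^ (i + e + 1)) ^ 2 = L * q ^ (2 * (i + e + 1) + 1) by rw [hL]; ring,
    show ellTheta (q ^ (i + 1)) p = ellTheta (q * q ^ i) p by ring_nf] at hadd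
  set T := frenkelTuraevTerm q p a b c d B C D L l (i + e + 1) (i + 1)
  set T' := frenkelTuraevTerm q p (a * q ^ 2) (b * q) (c * q) (d * q) (B * q) (C * q) (D * q)
    (L * q) (l / q) (i + e + 1) i
  have hratio : ellTheta (L * q ^ (i + e + 1 + (i + 1))) p * ellTheta (l * q * q ^ e) p
        / (ellTheta (a * q * q ^ (i + e + 1 + (i + 1))) p * ellTheta (q * q ^ e) p)
      = ellTheta (L * q ^ (i + e + 1)) p * ellTheta (l * q * q ^ (i + e + 1)) p
          / (ellTheta (a * q * q ^ (i + e + 1)) p * ellTheta (q * q ^ (i + e + 1)) p)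
        + q * q ^ e * ellTheta (L * q ^ (2 * (i + e + 1) + 1)) p
          / (ellTheta (a * q * q ^ (i + e + 1)) p * ellTheta (q * q ^ (i + e + 1)) p)
          * (ellTheta (a * q ^ (i + 1)) p * ellTheta (q * q ^ i) p * ellTheta l p
          / (ellTheta (a * q * q ^ (i + e + 1 + (i + 1))) p * ellTheta (q * q ^ e) p)) := by
    exact div_eq_div_add_of_sub_eq (mul_ne_zero h6 h7) (mul_ne_zero h4 h5)
      (by linear_combination hadd)
  rw [hratio]
  linear_combination (q * q ^ e * ellTheta (L * q ^ (2 * (i + e + 1) + 1)) p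
          / (ellTheta (a * q * q ^ (i + e + 1)) p * ellTheta (q * q ^ (i + e + 1)) p)) * hs

/-- The case of the recurrence for the last term, where the first summand is absent. -/
theorem frenkelTuraevTerm_top {q p a : ℂ} (b c d B C D L : ℂ) {l : ℂ} (n : ℕ)
    (hq : q ≠ 0) (h1 : ellTheta (a * q) p ≠ 0) (h4 : ellTheta (a * q * q ^ n) p ≠ 0) :
    frenkelTuraevTerm q p a b c d B C D L l (n + 1) (n + 1)
      = l * q * q ^ n * ellTheta L p * ellTheta (L * q ^ (2 * n + 1)) p
          * ellTheta a p * ellTheta b p * ellTheta c p * ellTheta d p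
          / (ellTheta (a * q * q ^ n) p * ellTheta (q * q ^ n) p
            * ellTheta (a * q ^ 2) p * ellTheta B p * ellTheta C p * ellTheta D p)
        * frenkelTuraevTerm q p (a * q ^ 2) (b * q) (c * q) (d * q) (B * q) (C * q) (D * q) (L * q)
          (l / q) n n := by
  have e1 : ellFac L q p (n + 1 + (n + 1))
      = ellTheta L p * (ellFac (L * q) q p (n + n) * ellTheta (L * q ^ (2 * n + 1)) p) := by
    rw [← add_assoc, ellFac_succ', show n + 1 + n = n + n + 1 by ring, ellFac_succ,
      show L * q * q ^ (n + n) = L * q ^ (2 * n + 1) by ring]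
  have e3 : ellFac (a * q) q p (n + 1 + (n + 1))
      = ellTheta (a * q) p * (ellTheta (a * q ^ 2) p * ellFac (a * q ^ 2 * q) q p (n + n)) := by
    rw [← add_assoc, ellFac_succ', show n + 1 + n = n + n + 1 by ring, ellFac_succ',
      show a * q * q = a * q ^ 2 by ring]
  have e4 : ellFac a q p (n + 1) * ellTheta (a * q * q ^ n) p
      = ellTheta a p * (ellTheta (a * q) p * ellFac (a * q ^ 2) q p n) := by
    rw [show a * q * q ^ n = a * q ^ (n + 1) by ring, ← ellFac_succ, ellFac_succ', ellFac_succ',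
      show a * q * q = a * q ^ 2 by ring]
  replace e4 := eq_div_of_mul_eq h4 e4
  have e5 : a * q ^ (2 * (n + 1)) = a * q ^ 2 * q ^ (2 * n) := by ring
  unfold frenkelTuraevTerm
  rw [Nat.sub_self, Nat.sub_self, div_mul_cancel₀ l hq, e1, e3, e4, e5, ellFac_succ' b,
    ellFac_succ' c, ellFac_succ' d, ellFac_succ' B, ellFac_succ' C, ellFac_succ' D,
    ellFac_succ q q p n, ellFac_zero, ellFac_zero, ellFac_zero]
  refine eq_of_eq_mul_mul_inv h1 ?_
  ring

/-- The Frenkel–Turaev sum, the elliptic analogue of Jackson's sum of a balanced very-well-poised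
series. By the addition formula, the sum of length `n + 1` is a combination of the sums of
length `n` with the parameters `a, b, c, d` and `a q², b q, c q, d q`, and the right-hand side
satisfies the same recurrence, again by the addition formula. -/
theorem sum_frenkelTuraevTerm {q p : ℂ} (hp : ‖p‖ < 1) (hq : q ≠ 0) (n : ℕ) :
    ∀ {a b c d B C D L l : ℂ}, b ≠ 0 → c ≠ 0 → d ≠ 0 → l ≠ 0 →
      b * c * d * l = a → B * b = a * q → C * c = a * q → D * d = a * q → L = a * l * q →
      (∀ k < n, ellTheta (q * q ^ k) p ≠ 0) → (∀ k < 2 * n, ellTheta (a * q * q ^ k) p ≠ 0) →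
      (∀ k < n, ellTheta (B * q ^ k) p ≠ 0) → (∀ k < n, ellTheta (C * q ^ k) p ≠ 0) →
      (∀ k < n, ellTheta (D * q ^ k) p ≠ 0) →
      ∑ i ∈ range (n + 1), frenkelTuraevTerm q p a b c d B C D L l n i
        = ellTheta a p * (ellFac L q p n * ellFac (l * b * q) q p n * ellFac (l * c * q) q p n
          * ellFac (l * d * q) q p n)
          / (ellFac q q p n * ellFac B q p n * ellFac C q p n * ellFac D q p n) := by
  induction n with
  | zero =>
    intros
    simp [frenkelTuraevTerm, ellFac_zero]
  | succ n ih =>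
    intro a b c d B C D L l hb hc hd hl hbal hB hC hD hL h0 h1 hB0 hC0 hD0
    have ha : a ≠ 0 := by rw [← hbal]; positivity
    have i1 := ih hb hc hd hl hbal hB hC hD hL (fun k hk => h0 k (by omega))
      (fun k hk => h1 k (by omega)) (fun k hk => hB0 k (by omega)) (fun k hk => hC0 k (by omega))
      (fun k hk => hD0 k (by omega))
    have i2 := ih (a := a * q ^ 2) (b := b * q) (c := c * q) (d := d * q) (B := B * q) (C := C * q)
      (D := D * q) (L := L * q) (l := l / q) (by positivity) (by positivity) (by positivity)
      (by positivity) (by rw [← hbal]; field_simp) (by linear_combination q ^ 2 * hB)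
      (by linear_combination q ^ 2 * hC) (by linear_combination q ^ 2 * hD)
      (by rw [hL]; field_simp) (fun k hk => h0 k (by omega))
      (fun k hk => by convert h1 (k + 2) (by omega) using 2; ring)
      (fun k hk => by convert hB0 (k + 1) (by omega) using 2; ring)
      (fun k hk => by convert hC0 (k + 1) (by omega) using 2; ring)
      (fun k hk => by convert hD0 (k + 1) (by omega) using 2; ring)
    have haq : ellTheta (a * q) p ≠ 0 := by simpa using h1 0 (by omega)
    have haq2 : ellTheta (a * q ^ 2) p ≠ 0 := by convert h1 1 (by omega) using 2; ring
    have hBz : ellTheta B p ≠ 0 := by simpa using hB0 0 (by omega)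
    have hCz : ellTheta C p ≠ 0 := by simpa using hC0 0 (by omega)
    have hDz : ellTheta D p ≠ 0 := by simpa using hD0 0 (by omega)
    set u := ellTheta (L * q ^ n) p * ellTheta (l * q * q ^ n) p
      / (ellTheta (a * q * q ^ n) p * ellTheta (q * q ^ n) p) with hu
    set v := l * q * q ^ n * ellTheta L p * ellTheta (L * q ^ (2 * n + 1)) p
          * ellTheta a p * ellTheta b p * ellTheta c p * ellTheta d p
          / (ellTheta (a * q * q ^ n) p * ellTheta (q * q ^ n) p
            * ellTheta (a * q ^ 2) p * ellTheta B p * ellTheta C p * ellTheta D p) with hv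
    have hrec : ∑ i ∈ range (n + 1 + 1), frenkelTuraevTerm q p a b c d B C D L l (n + 1) i
        = u * ∑ i ∈ range (n + 1), frenkelTuraevTerm q p a b c d B C D L l n i
          + v * ∑ i ∈ range (n + 1), frenkelTuraevTerm q p (a * q ^ 2) (b * q) (c * q) (d * q)
            (B * q) (C * q) (D * q) (L * q) (l / q) n i := by
      rw [sum_range_succ', sum_range_succ, sum_range_succ' _ n, sum_range_succ _ n,
        frenkelTuraevTerm_top _ _ _ _ _ _ _ _ hq haq (h1 n (by omega)),
        frenkelTuraevTerm_succ_left _ _ _ _ _ _ _ _ (Nat.zero_le n),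
        sum_congr rfl (g := fun i => u * frenkelTuraevTerm q p a b c d B C D L l n (i + 1)
          + v * frenkelTuraevTerm q p (a * q ^ 2) (b * q) (c * q) (d * q)
            (B * q) (C * q) (D * q) (L * q) (l / q) n i), sum_add_distrib, ← mul_sum, ← mul_sum]
      · rw [add_zero, Nat.sub_zero]
        ring
      · intro i hi
        obtain ⟨e, rfl⟩ : ∃ e, n = i + e + 1 :=
          ⟨n - i - 1, by have := mem_range.1 hi; omega⟩
        exact frenkelTuraevTerm_recurrence b c d B C D hp ha hl hq hL haq (h0 i (by omega))
          (h1 _ (by omega)) (h0 _ (by omega)) (h1 _ (by omega)) (h0 _ (by omega))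
    -- the addition formula behind the recurrence of the right-hand side
    have hadd := ellTheta_addition' hp (a := b / c) (l := d) (y := c) (z := l * c * (q * q ^ n))
      (by positivity) hd hc (by positivity)
    have hBn : B * q ^ n = c * d * l * (q * q ^ n) :=
      mul_right_cancel₀ hb (by linear_combination q ^ n * hB - q ^ n * q * hbal)
    have hCn : C * q ^ n = b * d * l * (q * q ^ n) :=
      mul_right_cancel₀ hc (by linear_combination q ^ n * hC - q ^ n * q * hbal)
    have hDn : D * q ^ n = b * c * l * (q * q ^ n) :=
      mul_right_cancel₀ hd (by linear_combination q ^ n * hD - q ^ n * q * hbal)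
    rw [show b / c * d * (l * c * (q * q ^ n)) * c = a * q * q ^ n by
        rw [← hbal]; field_simp,
      show d * (l * c * (q * q ^ n)) / c = l * d * q * q ^ n by field_simp,
      show b / c * (l * c * (q * q ^ n)) = l * b * q * q ^ n by field_simp,
      show l * c * (q * q ^ n) = l * c * q * q ^ n by ring,
      show b / c * d * (l * c * q * q ^ n) = C * q ^ n by rw [hCn]; field_simp,
      show d * (l * c * q * q ^ n) = B * q ^ n by rw [hBn]; ring,
      show l * b * q * q ^ n * c = D * q ^ n by rw [hDn]; ring,
      show l * c * q * q ^ n / c = l * q * q ^ n by field_simp,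
      show b / c * c = b by field_simp,
      show b / c * d * (l * c * q * q ^ n) ^ 2 = L * q ^ (2 * n + 1) by
        rw [hL, ← hbal]; field_simp; ring] at hadd
    have hs (x : ℂ) (hx : ellTheta x p ≠ 0) :
        ellFac (x * q) q p n = ellFac x q p n * ellTheta (x * q ^ n) p / ellTheta x p := by
      rw [eq_div_iff hx, mul_comm, ← ellFac_succ', ellFac_succ]
    have hs' : ellTheta L p * ellFac (L * q) q p n = ellFac L q p n * ellTheta (L * q ^ n) p := by
      rw [← ellFac_succ', ellFac_succ]
    have z0 := h0 n (by omega)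
    have z1 := h1 n (by omega)
    have z2 := hB0 n (by omega)
    have z3 := hC0 n (by omega)
    have z4 := hD0 n (by omega)
    have y0 : ellFac q q p n ≠ 0 := ellFac_ne_zero fun k hk => h0 k (by omega)
    have y2 : ellFac B q p n ≠ 0 := ellFac_ne_zero fun k hk => hB0 k (by omega)
    have y3 : ellFac C q p n ≠ 0 := ellFac_ne_zero fun k hk => hC0 k (by omega)
    have y4 : ellFac D q p n ≠ 0 := ellFac_ne_zero fun k hk => hD0 k (by omega)
    rw [hrec, i1, i2, show l / q * (b * q) * q = l * b * q by field_simp,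
      show l / q * (c * q) * q = l * c * q by field_simp,
      show l / q * (d * q) * q = l * d * q by field_simp, hs B hBz, hs C hCz, hs D hDz]
    simp only [ellFac_succ]
    rw [hu, hv]
    clear hrec i1 i2 ih hs hbal hB hC hD hL h0 h1 hB0 hC0 hD0 hBn hCn hDn hu hv u v
    generalize ellTheta (L * q ^ n) p = Ln at *
    generalize ellTheta (l * q * q ^ n) p = ln at *
    generalize ellTheta (a * q * q ^ n) p = an at *
    generalize ellTheta (q * q ^ n) p = qn at *
    generalize ellTheta (B * q ^ n) p = Bn at *
    generalize ellTheta (C * q ^ n) p = Cn at *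
    generalize ellTheta (D * q ^ n) p = Dn at *
    generalize ellTheta (l * b * q * q ^ n) p = bn at *
    generalize ellTheta (l * c * q * q ^ n) p = cn at *
    generalize ellTheta (l * d * q * q ^ n) p = dn at *
    generalize ellTheta (L * q ^ (2 * n + 1)) p = L2 at *
    generalize ellTheta L p = tL at *
    generalize ellTheta a p = ta at *
    generalize ellTheta b p = tb at *
    generalize ellTheta c p = tc at *
    generalize ellTheta d p = td at *
    generalize ellTheta B p = tB at *
    generalize ellTheta C p = tC at *
    generalize ellTheta D p = tD at *
    generalize ellTheta (a * q ^ 2) p = ta2 at *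
    generalize ellFac L q p n = EL at *
    generalize ellFac (L * q) q p n = ELq at *
    generalize ellFac q q p n = Eq at *
    generalize ellFac B q p n = EB at *
    generalize ellFac C q p n = EC at *
    generalize ellFac D q p n = ED at *
    generalize ellFac (l * b * q) q p n = Eb at *
    generalize ellFac (l * c * q) q p n = Ec at *
    generalize ellFac (l * d * q) q p n = Ed at *
    field_simp
    linear_combination ta * Eb * Ec * Ed
      * (l * q * q ^ n * L2 * tb * tc * td * hs' - EL * Ln * hadd)

/-- The quotient of two factorials `(q^{1-n}/z)_i / (q^{1-n}/y)_i` with `n = i + e`, as they occur in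
terminating series, in terms of factorials with the parameters `y` and `z`. -/
theorem ellFac_reverse_div {y z q p : ℂ} (hp : ‖p‖ < 1) (hy : y ≠ 0) (hz : z ≠ 0) (hq : q ≠ 0)
    (i e : ℕ) (hyf : ellFac y q p (i + e) ≠ 0) (hzf : ellFac z q p (i + e) ≠ 0) :
    ellFac ((z * q ^ (i + e))⁻¹ * q) q p i / ellFac ((y * q ^ (i + e))⁻¹ * q) q p i
      = ellFac z q p (i + e) * ellFac y q p e / (ellFac y q p (i + e) * ellFac z q p e)
        * (y / z) ^ i := by
  have h1 := ellFac_reverse hp hy hq i e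
  have h2 := ellFac_reverse hp hz hq i e
  have hprod : ∏ t ∈ range i, (-(y * q ^ (e + t)))
      = (y / z) ^ i * ∏ t ∈ range i, (-(z * q ^ (e + t))) := by
    rw [← card_range i, ← prod_const, card_range, ← prod_mul_distrib]
    exact prod_congr rfl fun t _ => by field_simp
  rw [← h1] at hyf
  rw [← h2] at hzf
  rw [← h1, ← h2, hprod]
  have y1 := right_ne_zero_of_mul (left_ne_zero_of_mul hyf)
  have y2 := left_ne_zero_of_mul (left_ne_zero_of_mul hyf)
  have z1 := right_ne_zero_of_mul (left_ne_zero_of_mul hzf)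
  have z2 := left_ne_zero_of_mul (left_ne_zero_of_mul hzf)
  have z3 := right_ne_zero_of_mul hzf
  generalize ellFac ((z * q ^ (i + e))⁻¹ * q) q p i = Z at *
  generalize ellFac ((y * q ^ (i + e))⁻¹ * q) q p i = Y at *
  generalize ∏ t ∈ range i, (-(z * q ^ (e + t))) = P at *
  generalize ellFac y q p e = Ye at *
  generalize ellFac z q p e = Ze at *
  have : (y / z) ^ i ≠ 0 := by positivity
  generalize (y / z) ^ i = w at *
  field_simp

/-- A specialization of the Frenkel–Turaev sum in which three of the pairs of factors are written
symmetrically in `n + i` and `n - i`. -/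
theorem sum_frenkelTuraev_symmetric {q p a c x y z : ℂ} (hp : ‖p‖ < 1) (hq : q ≠ 0) (n : ℕ)
    (ha : a ≠ 0) (hc : c ≠ 0) (hx : x ≠ 0) (hy : y ≠ 0) (hxyz : x * y * c = z)
    (h0 : ∀ k < n, ellTheta (q * q ^ k) p ≠ 0) (h1 : ∀ k < 2 * n, ellTheta (a * q * q ^ k) p ≠ 0)
    (h2 : ∀ k < n, ellTheta (a * q / c * q ^ k) p ≠ 0) (h3 : ∀ k < n, ellTheta (z * q ^ k) p ≠ 0)
    (h4 : ∀ k < n, ellTheta (y * q ^ k) p ≠ 0)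
    (h5 : ∀ k < 2 * n, ellTheta (a * z * q ^ k) p ≠ 0)
    (h6 : ∀ k < n, ellTheta (a * x * y * q ^ k) p ≠ 0) :
    ∑ i ∈ range (n + 1), ellTheta (a * q ^ (2 * i)) p
        * (ellFac a q p i * ellFac c q p i / (ellFac q q p i * ellFac (a * q / c) q p i))
        * (ellFac (a * x) q p (n + i) * ellFac x q p (n - i)
          * (ellFac (a * y) q p (n + i) * ellFac y q p (n - i))
          / (ellFac (a * q) q p (n + i) * ellFac q q p (n - i)
            * (ellFac (a * z) q p (n + i) * ellFac z q p (n - i)))) * c⁻¹ ^ i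
      = ellTheta a p * (ellFac (a * x) q p n * ellFac (a * y) q p n * ellFac (c * x) q p n
          * ellFac (c * y) q p n * ellFac (a * x * y) q p (2 * n))
        / (ellFac q q p n * ellFac (a * q / c) q p n * ellFac z q p n
          * ellFac (a * x * y) q p n * ellFac (a * z) q p (2 * n)) * c⁻¹ ^ n := by
  have hz : z ≠ 0 := by rw [← hxyz]; positivity
  have f0 : ellFac q q p n ≠ 0 := ellFac_ne_zero h0
  have fz : ellFac z q p n ≠ 0 := ellFac_ne_zero h3
  have fy : ellFac y q p n ≠ 0 := ellFac_ne_zero h4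
  have faz : ellFac (a * z) q p n ≠ 0 := ellFac_ne_zero fun k hk => h5 k (by omega)
  have faxy : ellFac (a * x * y) q p n ≠ 0 := ellFac_ne_zero h6
  have hft := sum_frenkelTuraevTerm hp hq n (a := a) (b := (z * q ^ n)⁻¹ * q) (c := c)
    (d := a * y * q ^ n) (B := a * z * q ^ n) (C := a * q / c) (D := (y * q ^ n)⁻¹ * q)
    (L := a * x) (l := x / q) (by positivity) hc (by positivity) (by positivity)
    (by rw [← hxyz]; field_simp) (by field_simp) (by field_simp) (by field_simp) (by field_simp)
    h0 h1 (fun k hk => by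
      convert h5 (n + k) (by omega) using 2; ring) h2
    (fun k hk => by
      obtain ⟨e, rfl⟩ : ∃ e, n = k + 1 + e := ⟨n - (k + 1), by omega⟩
      rw [show (y * q ^ (k + 1 + e))⁻¹ * q * q ^ k = (y * q ^ e)⁻¹ by field_simp; ring,
        ellTheta_inv (by positivity) hp]
      exact mul_ne_zero (neg_ne_zero.2 (by positivity)) (h4 e (by omega)))
  have hterm : ∀ i ∈ range (n + 1), ellTheta (a * q ^ (2 * i)) p
        * (ellFac a q p i * ellFac c q p i / (ellFac q q p i * ellFac (a * q / c) q p i))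
        * (ellFac (a * x) q p (n + i) * ellFac x q p (n - i)
          * (ellFac (a * y) q p (n + i) * ellFac y q p (n - i))
          / (ellFac (a * q) q p (n + i) * ellFac q q p (n - i)
            * (ellFac (a * z) q p (n + i) * ellFac z q p (n - i)))) * c⁻¹ ^ i
      = frenkelTuraevTerm q p a ((z * q ^ n)⁻¹ * q) c (a * y * q ^ n) (a * z * q ^ n) (a * q / c)
          ((y * q ^ n)⁻¹ * q) (a * x) (x / q) n i
        * (ellFac (a * y) q p n * ellFac y q p n / (ellFac (a * z) q p n * ellFac z q p n)) := by
    intro i hi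
    obtain ⟨e, rfl⟩ : ∃ e, n = i + e := ⟨n - i, by have := mem_range.1 hi; omega⟩
    have hr := ellFac_reverse_div hp hy hz hq i e fy fz
    have hw : c⁻¹ ^ i = x ^ i * (y / z) ^ i := by
      rw [← mul_pow, ← hxyz]; congr 1; field_simp
    unfold frenkelTuraevTerm
    rw [ellFac_add (a * y), ellFac_add (a * z), show i + e - i = e by omega, div_mul_cancel₀ _ hq,
      hw]
    calc _ = ellTheta (a * q ^ (2 * i)) p
        * (ellFac a q p i * ellFac c q p i / (ellFac q q p i * ellFac (a * q / c) q p i))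
        * (ellFac (a * x) q p (i + e + i) * ellFac x q p e
          / (ellFac (a * q) q p (i + e + i) * ellFac q q p e))
          * (ellFac (a * y) q p (i + e) / ellFac (a * z) q p (i + e))
          * (ellFac (a * y * q ^ (i + e)) q p i / ellFac (a * z * q ^ (i + e)) q p i)
          * x ^ i * (ellFac y q p (i + e) / ellFac z q p (i + e))
          * (ellFac z q p (i + e) * ellFac y q p e / (ellFac y q p (i + e) * ellFac z q p e)
            * (y / z) ^ i) := by
          refine (eq_of_eq_mul_mul_inv fy (eq_of_eq_mul_mul_inv fz ?_)).symm
          ring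
      _ = _ := by
          rw [← hr]
          ring
  rw [sum_congr rfl hterm, ← sum_mul, hft]
  have e1 : x / q * ((z * q ^ n)⁻¹ * q) * q = (c * y * q ^ (n + 0))⁻¹ * q := by
    rw [← hxyz, add_zero]; field_simp
  have e2 : ellFac ((c * y * q ^ (n + 0))⁻¹ * q) q p n * ∏ t ∈ range n, (-(c * y * q ^ (0 + t)))
      = ellFac (c * y) q p n := by
    simpa [ellFac_zero] using ellFac_reverse hp (mul_ne_zero hc hy) hq n 0
  have e3 : ellFac ((y * q ^ n)⁻¹ * q) q p n * ∏ t ∈ range n, (-(y * q ^ (0 + t)))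
      = ellFac y q p n := by
    simpa [ellFac_zero] using ellFac_reverse hp hy hq n 0
  have e4 : ∏ t ∈ range n, (-(c * y * q ^ (0 + t))) = c ^ n * ∏ t ∈ range n, (-(y * q ^ (0 + t))) := by
    rw [← card_range n, ← prod_const, card_range, ← prod_mul_distrib]
    exact prod_congr rfl fun t _ => by ring
  have e5 := ellFac_add (a * x * y) q p n n
  have e6 := ellFac_add (a * z) q p n n
  rw [← two_mul] at e5 e6
  have faz2 : ellFac (a * z) q p (2 * n) ≠ 0 := ellFac_ne_zero h5
  have fC : ellFac (a * q / c) q p n ≠ 0 := ellFac_ne_zero h2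
  rw [e1, e5, e6, ← e2, e4, show x / q * c * q = c * x by field_simp,
    show x / q * (a * y * q ^ n) * q = a * x * y * q ^ n by field_simp]
  rw [e6] at faz2
  have faz3 := right_ne_zero_of_mul faz2
  rw [← e3] at fy ⊢
  have fy1 := left_ne_zero_of_mul fy
  have fy2 := right_ne_zero_of_mul fy
  generalize ellFac ((y * q ^ n)⁻¹ * q) q p n = Y at *
  generalize ∏ t ∈ range n, (-(y * q ^ (0 + t))) = P at *
  generalize ellFac ((c * y * q ^ (n + 0))⁻¹ * q) q p n = CY at *
  generalize ellFac (a * x) q p n = AX at *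
  generalize ellFac (c * x) q p n = CX at *
  generalize ellFac (a * y) q p n = AY at *
  generalize ellFac (a * z) q p n = AZ at *
  generalize ellFac (a * z * q ^ n) q p n = AZ2 at *
  generalize ellFac (a * x * y) q p n = AXY at *
  generalize ellFac (a * x * y * q ^ n) q p n = AXY2 at *
  generalize ellFac (a * q / c) q p n = C at *
  generalize ellFac q q p n = Q at *
  generalize ellFac z q p n = Z at *
  rw [inv_pow]
  field_simp

/-! ### The well-poised kernel and its inversion -/

/-- The kernel `(B)_{n+j} (B/A)_{n-j} / ((Aq)_{n+j} (q)_{n-j})` of the elliptic well-poised Bailey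
lemma; it vanishes above the diagonal. -/
noncomputable def baileyKernel (A B q p : ℂ) (n j : ℕ) : ℂ :=
  if j ≤ n then ellFac B q p (n + j) * ellFac (B / A) q p (n - j)
    / (ellFac (A * q) q p (n + j) * ellFac q q p (n - j)) else 0

theorem baileyKernel_of_lt {A B q p : ℂ} {n j : ℕ} (h : n < j) : baileyKernel A B q p n j = 0 :=
  if_neg (by omega)

theorem baileyKernel_of_le {A B q p : ℂ} {n j : ℕ} (h : j ≤ n) :
    baileyKernel A B q p n j = ellFac B q p (n + j) * ellFac (B / A) q p (n - j)
      / (ellFac (A * q) q p (n + j) * ellFac q q p (n - j)) := if_pos h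

theorem sum_range_eq_sum_shift {f : ℕ → ℂ} {r t N : ℕ} (hN : r + t < N)
    (h : ∀ m, m < r ∨ r + t < m → f m = 0) :
    ∑ m ∈ range N, f m = ∑ i ∈ range (t + 1), f (r + i) := by
  rw [← sum_subset (s₁ := Ico r (r + t + 1)), sum_Ico_eq_sum_range,
    show r + t + 1 - r = t + 1 by omega]
  · intro m hm
    have := mem_Ico.1 hm
    exact mem_range.2 (by omega)
  · intro m _ hm
    refine h m ?_
    rw [mem_Ico] at hm
    omega

/-- Orthogonality of the kernels with the two parameters interchanged: this is the
Frenkel–Turaev sum with two pairs of factors cancelling each other, whose value contains the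
factor `(1; q, p)_t`. -/
theorem sum_baileyKernel_mul_baileyKernel {A B q p : ℂ} (hp : ‖p‖ < 1) (hq : q ≠ 0) (hA : A ≠ 0)
    (hB : B ≠ 0) (m t : ℕ) (h0 : ∀ k < t, ellTheta (q * q ^ k) p ≠ 0)
    (h1 : ∀ k, ellTheta (A * q ^ k) p ≠ 0) (h2 : ∀ k, ellTheta (B * q ^ k) p ≠ 0) :
    ∑ i ∈ range (t + 1), ellTheta (A * q ^ (2 * (m + i))) p * baileyKernel A B q p (m + t) (m + i)
        * (B / A) ^ (m + i) * baileyKernel B A q p (m + i) m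
      = if t = 0 then ellTheta A p * ellTheta B p / ellTheta (B * q ^ (2 * m)) p * (B / A) ^ m
        else 0 := by
  split_ifs with ht
  · subst ht
    have hs (x : ℂ) (hx : ∀ k, ellTheta (x * q ^ k) p ≠ 0) : ellFac x q p (m + m)
        / ellFac (x * q) q p (m + m) = ellTheta x p / ellTheta (x * q ^ (2 * m)) p := by
      have h := ellFac_succ' x q p (m + m)
      rw [ellFac_succ, ← two_mul] at h
      rw [← two_mul, div_eq_div_iff _ (hx _), h]
      refine ellFac_ne_zero fun k _ => ?_
      convert hx (k + 1) using 2
      ring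
    have hA1 := hs A h1
    have hB1 := hs B h2
    simp only [zero_add, range_one, sum_singleton, add_zero, baileyKernel_of_le le_rfl,
      Nat.sub_self, ellFac_zero, mul_one]
    calc _ = ellTheta (A * q ^ (2 * m)) p * (ellFac A q p (m + m) / ellFac (A * q) q p (m + m))
          * (ellFac B q p (m + m) / ellFac (B * q) q p (m + m)) * (B / A) ^ m := by ring
      _ = _ := by
        rw [hA1, hB1]
        have := h1 (2 * m)
        field_simp
  · -- here `c = D` and `d = C`, so that two of the pairs of factors cancel
    have hft := sum_frenkelTuraevTerm hp hq t (a := A * q ^ (2 * m)) (b := A / B)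
      (c := A * q ^ (2 * m)) (d := q) (B := B * q ^ (2 * m) * q) (C := q) (D := A * q ^ (2 * m))
      (L := B * q ^ (2 * m)) (l := B / A / q) (by positivity) (by positivity) hq (by positivity)
      (by field_simp) (by field_simp) (by ring) rfl (by field_simp) h0
      (fun k _ => by convert h1 (2 * m + 1 + k) using 2; ring)
      (fun k _ => by convert h2 (2 * m + 1 + k) using 2; ring) h0
      (fun k _ => by convert h1 (2 * m + k) using 2; ring)
    have hone : ellFac (B / A / q * (A / B) * q) q p t = 0 := by
      rw [show B / A / q * (A / B) * q = 1 by field_simp]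
      obtain ⟨t, rfl⟩ := Nat.exists_eq_succ_of_ne_zero ht
      rw [ellFac_succ', ellTheta_one, zero_mul]
    rw [hone] at hft
    simp only [mul_zero, zero_mul, zero_div] at hft
    rw [sum_congr rfl (g := fun i => frenkelTuraevTerm q p (A * q ^ (2 * m)) (A / B)
      (A * q ^ (2 * m)) q (B * q ^ (2 * m) * q) q (A * q ^ (2 * m)) (B * q ^ (2 * m)) (B / A / q)
      t i * (ellFac B q p (2 * m) * ellFac A q p (2 * m) / (ellFac (A * q) q p (2 * m)
        * ellFac (B * q) q p (2 * m)) * (B / A) ^ m)), ← sum_mul, hft, zero_mul]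
    intro i hi
    have hi := mem_range.1 hi
    rw [baileyKernel_of_le (by omega), baileyKernel_of_le (by omega),
      show m + t + (m + i) = 2 * m + (t + i) by ring, show m + i + m = 2 * m + i by ring,
      show m + t - (m + i) = t - i by omega, show m + i - m = i by omega]
    unfold frenkelTuraevTerm
    simp only [ellFac_add _ q p (2 * m)]
    rw [div_mul_cancel₀ _ hq, show A * q ^ (2 * (m + i)) = A * q ^ (2 * m) * q ^ (2 * i) by ring,
      show A * q ^ (2 * m) * q = A * q * q ^ (2 * m) by ring,
      show B * q ^ (2 * m) * q = B * q * q ^ (2 * m) by ring]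
    have f1 : ellFac (A * q ^ (2 * m)) q p i ≠ 0 := ellFac_ne_zero fun k _ => by
      convert h1 (2 * m + k) using 2; ring
    have f2 : ellFac q q p i ≠ 0 := ellFac_ne_zero fun k hk => h0 k (by omega)
    refine (eq_of_eq_mul_mul_inv f1 (eq_of_eq_mul_mul_inv f2 ?_)).symm
    ring

/-- Inversion of the elliptic well-poised Bailey transform. -/
theorem baileyKernel_inversion {A B q p : ℂ} (hp : ‖p‖ < 1) (hq : q ≠ 0) (hA : A ≠ 0)
    (hB : B ≠ 0) (n : ℕ) (h0 : ∀ k < n, ellTheta (q * q ^ k) p ≠ 0)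
    (h1 : ∀ k, ellTheta (A * q ^ k) p ≠ 0) (h2 : ∀ k, ellTheta (B * q ^ k) p ≠ 0) (w : ℕ → ℂ) :
    ∑ j ∈ range (n + 1), ellTheta (A * q ^ (2 * j)) p * baileyKernel A B q p n j * (B / A) ^ j
        * ∑ m ∈ range (n + 1), baileyKernel B A q p j m * w m
      = ellTheta A p * ellTheta B p / ellTheta (B * q ^ (2 * n)) p * (B / A) ^ n * w n := by
  simp only [mul_sum]
  rw [sum_comm, sum_eq_single n]
  · have h := sum_baileyKernel_mul_baileyKernel hp hq hA hB n 0 (by simp) h1 h2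
    rw [if_pos rfl] at h
    rw [← h, sum_range_eq_sum_shift (r := n) (t := 0) (by omega), sum_mul]
    · exact sum_congr rfl fun i _ => by rw [add_zero]; ring
    · rintro m (hm | hm)
      · rw [baileyKernel_of_lt hm]; ring
      · rw [baileyKernel_of_lt (n := n) (by omega)]; ring
  · intro m hm hne
    have hm := mem_range.1 hm
    obtain ⟨t, rfl⟩ : ∃ t, n = m + t := ⟨n - m, by omega⟩
    have h := sum_baileyKernel_mul_baileyKernel hp hq hA hB m t
      (fun k hk => h0 k (by omega)) h1 h2
    rw [if_neg (by omega)] at h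
    rw [← zero_mul (w m), ← h, sum_range_eq_sum_shift (r := m) (t := t) (by omega), sum_mul]
    · exact sum_congr rfl fun i _ => by ring
    · rintro j (hj | hj)
      · rw [baileyKernel_of_lt hj]; ring
      · rw [baileyKernel_of_lt (n := m + t) (by omega)]; ring
  · intro h; exact absurd (mem_range.2 (by omega)) h

/-! ### Generic parameters -/

/-- The parameters `a`, `b` are multiplicatively independent modulo the group generated by `q`
and `p`. For such parameters `θ(x; p)` does not vanish at a monomial `x` that involves `a` or `b`. -/
def IsGenericPair (a b q p : ℂ) : Prop :=
  ∀ i j k m : ℤ, (i ≠ 0 ∨ j ≠ 0) → a ^ i * b ^ j * q ^ k ≠ p ^ m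

/-- The hypothesis on `x` says that `x²` is a monomial in `a`, `b`, `q` that involves `a` or `b`.
Passing to the square allows for signs and for square roots in the argument `x`. -/
theorem IsGenericPair.ellTheta_ne_zero {a b q p P : ℂ} (h : IsGenericPair a b q p) (ha : a ≠ 0)
    (hb : b ≠ 0) (hq : q ≠ 0) (hp : ‖p‖ < 1) (hP : P = p ∨ P = p ^ 2) {x : ℂ}
    (i i' j j' k k' : ℕ) (hx : x ^ 2 * (a ^ i' * b ^ j' * q ^ k') = a ^ i * b ^ j * q ^ k)
    (hij : i ≠ i' ∨ j ≠ j') : ellTheta x P ≠ 0 := by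
  intro h0
  have hP1 : ‖P‖ < 1 := by
    rcases hP with rfl | rfl
    · exact hp
    · rw [norm_pow]; exact pow_lt_one₀ (norm_nonneg _) hp two_ne_zero
  obtain ⟨m, hm⟩ := exists_zpow_eq_of_ellTheta_eq_zero hP1 h0
  obtain ⟨m', hm'⟩ : ∃ m' : ℤ, x ^ 2 = p ^ m' := by
    rcases hP with rfl | rfl
    · exact ⟨m * 2, by rw [zpow_mul, hm]; norm_cast⟩
    · exact ⟨2 * m * 2, by rw [zpow_mul, zpow_mul, hm]; norm_cast⟩
  refine h (i - i') (j - j') (k - k') m' (by omega) ?_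
  rw [← hm', zpow_sub₀ ha, zpow_sub₀ hb, zpow_sub₀ hq]
  simp only [zpow_natCast]
  field_simp
  rw [← hx]
  ring

theorem ellTheta_ne_zero_of_sq {x p : ℂ} (hp : ‖p‖ < 1) (h : ellTheta (x ^ 2) (p ^ 2) ≠ 0) :
    ellTheta x p ≠ 0 ∧ ellTheta (-x) p ≠ 0 := by
  rw [ellTheta_sq x hp] at h
  exact ⟨left_ne_zero_of_mul h, right_ne_zero_of_mul h⟩

/-! ### The change of base from `q` to `q²` -/

/-- The kernels in base `q` and `q²` are intertwined by a summation formula in base `q`, the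
instance of the Frenkel–Turaev sum with parameters `b`, `b/a`, `± q^{-j}`, `± (abq)^{1/2} q^j`:
pairs of opposite parameters combine to factorials in base `q²` and nome `p²`. -/
theorem sum_baileyKernel_sq_mul_baileyKernel {a b q p : ℂ} (hp : ‖p‖ < 1) (ha : a ≠ 0) (hb : b ≠ 0)
    (hq : q ≠ 0) (hG : IsGenericPair a b q p) {j N : ℕ} (hj : j < N)
    (h0 : ∀ k < j, ellTheta (q ^ 2 * (q ^ 2) ^ k) (p ^ 2) ≠ 0) (r : ℕ) :
    ∑ m ∈ range N, baileyKernel (b ^ 2) (a * b * q) (q ^ 2) (p ^ 2) j m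
        * (ellTheta (b * q ^ (2 * m)) p * (a / b) ^ m * baileyKernel a b q p m r)
      = ellTheta b p * (a / b) ^ j * (ellFac (-a * q) q p (2 * j) / ellFac (-b * q) q p (2 * j))
        * baileyKernel (a ^ 2) (a * b * q) (q ^ 2) (p ^ 2) j r := by
  rcases lt_or_ge j r with hjr | hjr
  · rw [baileyKernel_of_lt hjr, mul_zero]
    refine sum_eq_zero fun m _ => ?_
    rcases lt_or_ge m r with hm | hm
    · rw [baileyKernel_of_lt hm]; ring
    · rw [baileyKernel_of_lt (n := j) (by omega)]; ring
  obtain ⟨t, rfl⟩ : ∃ t, j = r + t := ⟨j - r, by omega⟩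
  rw [sum_range_eq_sum_shift (r := r) (t := t) (by omega)]
  swap
  · rintro m (hm | hm)
    · rw [baileyKernel_of_lt hm]; ring
    · rw [baileyKernel_of_lt (n := r + t) (by omega)]; ring
  obtain ⟨s, hs⟩ : ∃ s, s ^ 2 = a * b * q := IsAlgClosed.exists_pow_nat_eq _ two_pos
  have hs0 : s ≠ 0 := by
    rintro rfl
    have : a * b * q ≠ 0 := by positivity
    exact this (by rw [← hs]; ring)
  have hN := fun x => hG.ellTheta_ne_zero ha hb hq hp (Or.inl rfl) (x := x)
  have g0 (k) (hk : k < t) := ellTheta_ne_zero_of_sq (x := q * q ^ k) hp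
    (by convert h0 k (by omega) using 2; ring)
  -- the choice `z = -q` makes the remaining pair of factors opposite to `b q` and `q`
  have hQ := sum_frenkelTuraev_symmetric hp hq t (a := b * q ^ (2 * r)) (c := b / a) (x := s / b)
    (y := -(s / b)) (z := -q) (by positivity) (by positivity) (by positivity)
    (neg_ne_zero.2 (by positivity)) (by field_simp; rw [hs]; ring) (fun k hk => (g0 k hk).1)
    (fun k hk => hN _ 0 0 2 0 (4 * r + 2 + 2 * k) 0 (by ring) (by simp))
    (fun k hk => hN _ 2 0 0 0 (4 * r + 2 + 2 * k) 0 (by field_simp; ring) (by simp))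
    (fun k hk => by convert (g0 k hk).2 using 2; ring)
    (fun k hk => hN _ 1 0 0 1 (1 + 2 * k) 0 (by field_simp; rw [hs]; ring) (by simp))
    (fun k hk => hN _ 0 0 2 0 (4 * r + 2 + 2 * k) 0 (by ring) (by simp))
    (fun k hk => hN _ 2 0 0 0 (4 * r + 2 + 2 * k) 0
      (by field_simp; rw [show s ^ 4 = (s ^ 2) ^ 2 by ring, hs]; ring) (by simp))
  have hbs : b * q ^ (2 * r) * (s / b) = s * q ^ (2 * r) := by field_simp
  have hbs' : b * q ^ (2 * r) * -(s / b) = -s * q ^ (2 * r) := by field_simp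
  have hab : b * q ^ (2 * r) * q / (b / a) = a * q * q ^ (2 * r) := by field_simp
  have hbq : b * q ^ (2 * r) * q = b * q * q ^ (2 * r) := by ring
  have hbq' : b * q ^ (2 * r) * -q = -(b * q) * q ^ (2 * r) := by ring
  have has : b / a * (s / b) = s / a := by field_simp
  have has' : b / a * -(s / b) = -(s / a) := by field_simp
  have haxy : s * q ^ (2 * r) * -(s / b) = -(a * q) * q ^ (2 * r) := by
    field_simp; rw [hs]; ring
  have hba : (b / a)⁻¹ = a / b := inv_div _ _
  rw [hab, hbs, haxy, hbs', hbq, hbq', has, has', hba] at hQ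
  have eb : b ^ 2 * q ^ 2 = (b * q) ^ 2 := by ring
  have ea : a ^ 2 * q ^ 2 = (a * q) ^ 2 := by ring
  have eb' : a * b * q / b ^ 2 = (s / b) ^ 2 := by rw [← hs, div_pow]
  have ea' : a * b * q / a ^ 2 = (s / a) ^ 2 := by rw [← hs, div_pow]
  rw [baileyKernel_of_le (by omega), ea, ea', show r + t - r = t by omega,
    show r + t + r = 2 * r + t by ring, mul_add 2 r t, ← hs]
  rw [sum_congr rfl (g := fun i => ellTheta (b * q ^ (2 * r) * q ^ (2 * i)) p
        * (ellFac (b * q ^ (2 * r)) q p i * ellFac (b / a) q p i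
          / (ellFac q q p i * ellFac (a * q * q ^ (2 * r)) q p i))
        * (ellFac (s * q ^ (2 * r)) q p (t + i) * ellFac (s / b) q p (t - i)
          * (ellFac (-s * q ^ (2 * r)) q p (t + i) * ellFac (-(s / b)) q p (t - i))
          / (ellFac (b * q * q ^ (2 * r)) q p (t + i) * ellFac q q p (t - i)
            * (ellFac (-(b * q) * q ^ (2 * r)) q p (t + i) * ellFac (-q) q p (t - i))))
          * (a / b) ^ i
        * ((a / b) ^ r * (ellFac s q p (2 * r) * ellFac (-s) q p (2 * r)
          / (ellFac (b * q) q p (2 * r) * ellFac (-(b * q)) q p (2 * r)))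
          * (ellFac b q p (2 * r) / ellFac (a * q) q p (2 * r)))), ← sum_mul, hQ]
  · have f1 : ellFac (b * q) q p (2 * r) ≠ 0 := ellFac_ne_zero fun k _ =>
      hN _ 0 0 2 0 (2 + 2 * k) 0 (by ring) (by simp)
    have f2 : ellFac (-(a * q)) q p (2 * r) ≠ 0 := ellFac_ne_zero fun k _ =>
      hN _ 2 0 0 0 (2 + 2 * k) 0 (by ring) (by simp)
    have e1 : ellFac b q p (2 * r) * ellTheta (b * q ^ (2 * r)) p
        = ellTheta b p * ellFac (b * q) q p (2 * r) := by rw [← ellFac_succ, ellFac_succ']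
    simp only [ellFac_sq _ _ hp, ellFac_add _ q p (2 * r), neg_mul a, neg_mul b]
    calc _ = (ellFac b q p (2 * r) * ellTheta (b * q ^ (2 * r)) p)
          * (ellFac (s * q ^ (2 * r)) q p t * ellFac (-s * q ^ (2 * r)) q p t
            * ellFac (s / a) q p t * ellFac (-(s / a)) q p t
            * ellFac (-(a * q) * q ^ (2 * r)) q p (2 * t))
          / (ellFac q q p t * ellFac (a * q * q ^ (2 * r)) q p t * ellFac (-q) q p t
            * ellFac (-(a * q) * q ^ (2 * r)) q p t * ellFac (-(b * q) * q ^ (2 * r)) q p (2 * t))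
          * (a / b) ^ t * ((a / b) ^ r * (ellFac s q p (2 * r) * ellFac (-s) q p (2 * r)
          / (ellFac (b * q) q p (2 * r) * ellFac (-(b * q)) q p (2 * r)))
          / ellFac (a * q) q p (2 * r)) := by ring
      _ = _ := by
        rw [e1]
        refine eq_of_eq_mul_mul_inv f1 (eq_of_eq_mul_mul_inv f2 ?_).symm
        ring
  · intro i hi
    have hi := mem_range.1 hi
    rw [baileyKernel_of_le (by omega), baileyKernel_of_le (by omega), eb, hs, eb', ← hs,
      show r + t + (r + i) = 2 * r + (t + i) by ring, show r + i + r = 2 * r + i by ring,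
      show r + t - (r + i) = t - i by omega, show r + i - r = i by omega,
      show b * q ^ (2 * (r + i)) = b * q ^ (2 * r) * q ^ (2 * i) by ring]
    simp only [ellFac_sq _ _ hp, ellFac_add _ q p (2 * r)]
    ring

/-! ### The quartic sum -/

/-- The coefficients of the series in base `q⁴` and nome `p²`. -/
noncomputable def quarticCoeff (a b q p : ℂ) (k : ℕ) : ℂ :=
  ellTheta (a ^ 2 * q ^ (8 * k)) (p ^ 2) / ellTheta (a ^ 2) (p ^ 2)
    * (ellFac (a ^ 2) (q ^ 4) (p ^ 2) k * ellFac (a ^ 2 / (b ^ 2 * q ^ 2)) (q ^ 4) (p ^ 2) k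
      / (ellFac (q ^ 4) (q ^ 4) (p ^ 2) k * ellFac (b ^ 2 * q ^ 6) (q ^ 4) (p ^ 2) k))
    * (a ^ 2 / (b ^ 2 * q ^ 2))⁻¹ ^ k

theorem ellFac_two_mul_add_one (x q p : ℂ) (k : ℕ) :
    ellFac x q p (2 * k + 1)
      = ellTheta x p * (ellFac (x * q) (q ^ 2) p k * ellFac (x * q * q) (q ^ 2) p k) := by
  rw [ellFac_succ', ellFac_two_mul]

/-- The even case of `sum_quarticCoeff_mul_baileyKernel`. -/
theorem sum_quarticCoeff_mul_baileyKernel_even {a b q p : ℂ} (hp : ‖p‖ < 1) (ha : a ≠ 0)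
    (hb : b ≠ 0) (hq : q ≠ 0) (hG : IsGenericPair a b q p) {t N : ℕ} (hj : 2 * t < N)
    (h0 : ∀ k < 2 * t, ellTheta (q ^ 2 * (q ^ 2) ^ k) (p ^ 2) ≠ 0) :
    ∑ k ∈ range N, quarticCoeff a b q p k
        * baileyKernel (a ^ 2) (a * b * q) (q ^ 2) (p ^ 2) (2 * t) (2 * k)
      = (-(b * q / a)) ^ (2 * t) * (ellFac (a / (b * q)) (q ^ 2) (p ^ 2) (2 * t)
          * ellFac (a * b * q) (q ^ 2) (p ^ 2) (2 * t)
          * ellFac (b ^ 2 * q ^ 4) (q ^ 4) (p ^ 2) (2 * t)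
        / (ellFac (b ^ 2 * q ^ 4) (q ^ 2) (p ^ 2) (2 * t) * ellFac (q ^ 2) (q ^ 2) (p ^ 2) (2 * t)
          * ellFac (a ^ 2 * q ^ 2) (q ^ 4) (p ^ 2) (2 * t))) := by
  have hp2 : ‖p ^ 2‖ < 1 := by rw [norm_pow]; exact pow_lt_one₀ (norm_nonneg _) hp two_ne_zero
  have hN := fun x => hG.ellTheta_ne_zero ha hb hq hp (Or.inr rfl) (x := x)
  have hQ := sum_frenkelTuraev_symmetric hp2 (q := q ^ 4) (by positivity) t (a := a ^ 2)
    (c := a ^ 2 / (b ^ 2 * q ^ 2)) (x := b * q / a) (y := b * q ^ 3 / a) (z := q ^ 2)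
    (by positivity) (by positivity) (by positivity) (by positivity) (by field_simp)
    (fun k hk => by convert h0 (2 * k + 1) (by omega) using 2; ring)
    (fun k _ => hN _ 4 0 0 0 (8 + 8 * k) 0 (by ring) (by simp))
    (fun k _ => hN _ 0 0 4 0 (12 + 8 * k) 0 (by field_simp; ring) (by simp))
    (fun k hk => by convert h0 (2 * k) (by omega) using 2; ring)
    (fun k _ => hN _ 0 2 2 0 (6 + 8 * k) 0 (by field_simp; ring) (by simp))
    (fun k _ => hN _ 4 0 0 0 (4 + 8 * k) 0 (by ring) (by simp))
    (fun k _ => hN _ 0 0 4 0 (8 + 8 * k) 0 (by field_simp; ring) (by simp))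
  have ha2 : ellTheta (a ^ 2) (p ^ 2) ≠ 0 := hN _ 4 0 0 0 0 0 (by ring) (by simp)
  rw [show a ^ 2 * q ^ 4 / (a ^ 2 / (b ^ 2 * q ^ 2)) = b ^ 2 * q ^ 6 by field_simp,
    show a ^ 2 * (b * q / a) = a * b * q by field_simp,
    show a ^ 2 * (b * q ^ 3 / a) = a * b * q * q ^ 2 by field_simp,
    show a ^ 2 / (b ^ 2 * q ^ 2) * (b * q / a) = a / (b * q) by field_simp,
    show a ^ 2 / (b ^ 2 * q ^ 2) * (b * q ^ 3 / a) = a / (b * q) * q ^ 2 by field_simp,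
    show a * b * q * (b * q ^ 3 / a) = b ^ 2 * q ^ 4 by field_simp,
    show a ^ 2 * q ^ 4 = a ^ 2 * q ^ 2 * q ^ 2 by ring,
    show b * q ^ 3 / a = a * b * q / a ^ 2 * q ^ 2 by field_simp,
    show b * q / a = a * b * q / a ^ 2 by field_simp] at hQ
  have h4 : (q ^ 2) ^ 2 = q ^ 4 := by ring
  rw [sum_range_eq_sum_shift (r := 0) (t := t) (by omega)]
  swap
  · rintro k (hk | hk)
    · omega
    · rw [baileyKernel_of_lt (by omega), mul_zero]
  simp only [zero_add]
  have hterm : ∀ k ∈ range (t + 1), quarticCoeff a b q p k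
        * baileyKernel (a ^ 2) (a * b * q) (q ^ 2) (p ^ 2) (2 * t) (2 * k)
      = ellTheta (a ^ 2 * (q ^ 4) ^ (2 * k)) (p ^ 2) *
            (ellFac (a ^ 2) (q ^ 4) (p ^ 2) k * ellFac (a ^ 2 / (b ^ 2 * q ^ 2)) (q ^ 4) (p ^ 2) k /
              (ellFac (q ^ 4) (q ^ 4) (p ^ 2) k * ellFac (b ^ 2 * q ^ 6) (q ^ 4) (p ^ 2) k)) *
          (ellFac (a * b * q) (q ^ 4) (p ^ 2) (t + k)
              * ellFac (a * b * q / a ^ 2) (q ^ 4) (p ^ 2) (t - k) *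
              (ellFac (a * b * q * q ^ 2) (q ^ 4) (p ^ 2) (t + k)
                * ellFac (a * b * q / a ^ 2 * q ^ 2) (q ^ 4) (p ^ 2) (t - k)) /
            (ellFac (a ^ 2 * q ^ 2 * q ^ 2) (q ^ 4) (p ^ 2) (t + k)
              * ellFac (q ^ 4) (q ^ 4) (p ^ 2) (t - k) *
              (ellFac (a ^ 2 * q ^ 2) (q ^ 4) (p ^ 2) (t + k)
                * ellFac (q ^ 2) (q ^ 4) (p ^ 2) (t - k)))) *
        (a ^ 2 / (b ^ 2 * q ^ 2))⁻¹ ^ k / ellTheta (a ^ 2) (p ^ 2) := by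
    intro k hk
    have hk := mem_range.1 hk
    rw [baileyKernel_of_le (by omega), show 2 * t + 2 * k = 2 * (t + k) by ring,
      show 2 * t - 2 * k = 2 * (t - k) by omega, quarticCoeff,
      show q ^ (8 * k) = (q ^ 4) ^ (2 * k) by ring]
    simp only [ellFac_two_mul, h4]
    rw [show q ^ 2 * q ^ 2 = q ^ 4 by ring]
    ring
  rw [sum_congr rfl hterm, ← sum_div, hQ]
  simp only [ellFac_two_mul _ (q ^ 2), h4]
  rw [show q ^ 2 * q ^ 2 = q ^ 4 by ring, show b ^ 2 * q ^ 4 * q ^ 2 = b ^ 2 * q ^ 6 by ring,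
    show (-(b * q / a)) ^ (2 * t) = (a ^ 2 / (b ^ 2 * q ^ 2))⁻¹ ^ t by
      rw [pow_mul]; congr 1; field_simp]
  refine eq_of_eq_mul_mul_inv ha2 ?_
  ring

/-- The odd case of `sum_quarticCoeff_mul_baileyKernel`. -/
theorem sum_quarticCoeff_mul_baileyKernel_odd {a b q p : ℂ} (hp : ‖p‖ < 1) (ha : a ≠ 0)
    (hb : b ≠ 0) (hq : q ≠ 0) (hG : IsGenericPair a b q p) {t N : ℕ} (hj : 2 * t + 1 < N)
    (h0 : ∀ k < 2 * t + 1, ellTheta (q ^ 2 * (q ^ 2) ^ k) (p ^ 2) ≠ 0) :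
    ∑ k ∈ range N, quarticCoeff a b q p k
        * baileyKernel (a ^ 2) (a * b * q) (q ^ 2) (p ^ 2) (2 * t + 1) (2 * k)
      = (-(b * q / a)) ^ (2 * t + 1) * (ellFac (a / (b * q)) (q ^ 2) (p ^ 2) (2 * t + 1)
          * ellFac (a * b * q) (q ^ 2) (p ^ 2) (2 * t + 1)
          * ellFac (b ^ 2 * q ^ 4) (q ^ 4) (p ^ 2) (2 * t + 1)
        / (ellFac (b ^ 2 * q ^ 4) (q ^ 2) (p ^ 2) (2 * t + 1)
          * ellFac (q ^ 2) (q ^ 2) (p ^ 2) (2 * t + 1)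
          * ellFac (a ^ 2 * q ^ 2) (q ^ 4) (p ^ 2) (2 * t + 1))) := by
  have hp2 : ‖p ^ 2‖ < 1 := by rw [norm_pow]; exact pow_lt_one₀ (norm_nonneg _) hp two_ne_zero
  have hN := fun x => hG.ellTheta_ne_zero ha hb hq hp (Or.inr rfl) (x := x)
  have hQ := sum_frenkelTuraev_symmetric hp2 (q := q ^ 4) (by positivity) t (a := a ^ 2)
    (c := a ^ 2 / (b ^ 2 * q ^ 2)) (x := b * q ^ 3 / a) (y := b * q ^ 5 / a) (z := q ^ 6)
    (by positivity) (by positivity) (by positivity) (by positivity) (by field_simp)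
    (fun k hk => by convert h0 (2 * k + 1) (by omega) using 2; ring)
    (fun k _ => hN _ 4 0 0 0 (8 + 8 * k) 0 (by ring) (by simp))
    (fun k _ => hN _ 0 0 4 0 (12 + 8 * k) 0 (by field_simp; ring) (by simp))
    (fun k hk => by convert h0 (2 * k + 2) (by omega) using 2; ring)
    (fun k _ => hN _ 0 2 2 0 (10 + 8 * k) 0 (by field_simp; ring) (by simp))
    (fun k _ => hN _ 4 0 0 0 (12 + 8 * k) 0 (by ring) (by simp))
    (fun k _ => hN _ 0 0 4 0 (16 + 8 * k) 0 (by field_simp; ring) (by simp))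
  have ha2 : ellTheta (a ^ 2) (p ^ 2) ≠ 0 := hN _ 4 0 0 0 0 0 (by ring) (by simp)
  have hb4 : ellTheta (b ^ 2 * q ^ 4) (p ^ 2) ≠ 0 := hN _ 0 0 4 0 8 0 (by ring) (by simp)
  rw [show a ^ 2 * q ^ 4 / (a ^ 2 / (b ^ 2 * q ^ 2)) = b ^ 2 * q ^ 6 by field_simp,
    show a ^ 2 * (b * q ^ 3 / a) = a * b * q * q ^ 2 by field_simp,
    show a ^ 2 * (b * q ^ 5 / a) = a * b * q * q ^ 2 * q ^ 2 by field_simp,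
    show a ^ 2 / (b ^ 2 * q ^ 2) * (b * q ^ 3 / a) = a / (b * q) * q ^ 2 by field_simp,
    show a ^ 2 / (b ^ 2 * q ^ 2) * (b * q ^ 5 / a) = a / (b * q) * q ^ 2 * q ^ 2 by field_simp,
    show a * b * q * q ^ 2 * (b * q ^ 5 / a) = b ^ 2 * q ^ 4 * q ^ 4 by field_simp,
    show a ^ 2 * q ^ 6 = a ^ 2 * q ^ 2 * q ^ 4 by ring,
    show a ^ 2 * q ^ 4 = a ^ 2 * q ^ 2 * q ^ 2 by ring,
    show b * q ^ 5 / a = a * b * q / a ^ 2 * q ^ 2 * q ^ 2 by field_simp,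
    show b * q ^ 3 / a = a * b * q / a ^ 2 * q ^ 2 by field_simp] at hQ
  have h4 : (q ^ 2) ^ 2 = q ^ 4 := by ring
  rw [sum_range_eq_sum_shift (r := 0) (t := t) (by omega)]
  swap
  · rintro k (hk | hk)
    · omega
    · rw [baileyKernel_of_lt (by omega), mul_zero]
  simp only [zero_add]
  have hterm : ∀ k ∈ range (t + 1), quarticCoeff a b q p k
        * baileyKernel (a ^ 2) (a * b * q) (q ^ 2) (p ^ 2) (2 * t + 1) (2 * k)
      = ellTheta (a ^ 2 * (q ^ 4) ^ (2 * k)) (p ^ 2) *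
            (ellFac (a ^ 2) (q ^ 4) (p ^ 2) k * ellFac (a ^ 2 / (b ^ 2 * q ^ 2)) (q ^ 4) (p ^ 2) k /
              (ellFac (q ^ 4) (q ^ 4) (p ^ 2) k * ellFac (b ^ 2 * q ^ 6) (q ^ 4) (p ^ 2) k)) *
          (ellFac (a * b * q * q ^ 2) (q ^ 4) (p ^ 2) (t + k)
              * ellFac (a * b * q / a ^ 2 * q ^ 2) (q ^ 4) (p ^ 2) (t - k) *
              (ellFac (a * b * q * q ^ 2 * q ^ 2) (q ^ 4) (p ^ 2) (t + k)
                * ellFac (a * b * q / a ^ 2 * q ^ 2 * q ^ 2) (q ^ 4) (p ^ 2) (t - k)) /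
            (ellFac (a ^ 2 * q ^ 2 * q ^ 2) (q ^ 4) (p ^ 2) (t + k)
              * ellFac (q ^ 4) (q ^ 4) (p ^ 2) (t - k) *
              (ellFac (a ^ 2 * q ^ 2 * q ^ 4) (q ^ 4) (p ^ 2) (t + k)
                * ellFac (q ^ 6) (q ^ 4) (p ^ 2) (t - k)))) *
        (a ^ 2 / (b ^ 2 * q ^ 2))⁻¹ ^ k * (ellTheta (a * b * q) (p ^ 2)
          * ellTheta (a * b * q / a ^ 2) (p ^ 2) / (ellTheta (a ^ 2 * q ^ 2) (p ^ 2)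
            * ellTheta (q ^ 2) (p ^ 2)) / ellTheta (a ^ 2) (p ^ 2)) := by
    intro k hk
    have hk := mem_range.1 hk
    rw [baileyKernel_of_le (by omega), show 2 * t + 1 + 2 * k = 2 * (t + k) + 1 by ring,
      show 2 * t + 1 - 2 * k = 2 * (t - k) + 1 by omega, quarticCoeff,
      show q ^ (8 * k) = (q ^ 4) ^ (2 * k) by ring]
    simp only [ellFac_two_mul_add_one, h4]
    rw [show q ^ 2 * q ^ 2 = q ^ 4 by ring, show q ^ 4 * q ^ 2 = q ^ 6 by ring,
      show a ^ 2 * q ^ 2 * q ^ 2 * q ^ 2 = a ^ 2 * q ^ 2 * q ^ 4 by ring]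
    ring
  -- this reflection supplies the sign and the odd power of `b q / a`
  have hinv : ellTheta (a * b * q / a ^ 2) (p ^ 2)
      = -(b * q / a) * ellTheta (a / (b * q)) (p ^ 2) := by
    rw [show a * b * q / a ^ 2 = (a / (b * q))⁻¹ by field_simp, ellTheta_inv (by positivity) hp2,
      inv_div]
  rw [sum_congr rfl hterm, ← sum_mul, hQ, hinv, ellFac_succ' (b ^ 2 * q ^ 4) (q ^ 4),
    ellFac_succ' (a ^ 2 * q ^ 2) (q ^ 4)]
  simp only [ellFac_two_mul_add_one _ (q ^ 2), h4]
  rw [show q ^ 2 * q ^ 2 = q ^ 4 by ring, show q ^ 4 * q ^ 2 = q ^ 6 by ring,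
    show b ^ 2 * q ^ 4 * q ^ 2 * q ^ 2 = b ^ 2 * q ^ 4 * q ^ 4 by ring,
    show b ^ 2 * q ^ 4 * q ^ 2 = b ^ 2 * q ^ 6 by ring,
    pow_succ (-(b * q / a)), show (-(b * q / a)) ^ (2 * t) = (a ^ 2 / (b ^ 2 * q ^ 2))⁻¹ ^ t by
      rw [pow_mul]; congr 1; field_simp]
  refine eq_of_eq_mul_mul_inv ha2 (eq_of_eq_mul_mul_inv hb4 ?_).symm
  ring

/-- The transform of the coefficients of the quartic series is a closed product: this is the
Frenkel–Turaev sum in base `q⁴`, in which the parameters `q^{-2j}` and `q^{2-2j}` both occur, so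
that either terminates the series, according to the parity of `j`. -/
theorem sum_quarticCoeff_mul_baileyKernel {a b q p : ℂ} (hp : ‖p‖ < 1) (ha : a ≠ 0)
    (hb : b ≠ 0) (hq : q ≠ 0) (hG : IsGenericPair a b q p) {j N : ℕ} (hj : j < N)
    (h0 : ∀ k < j, ellTheta (q ^ 2 * (q ^ 2) ^ k) (p ^ 2) ≠ 0) :
    ∑ k ∈ range N, quarticCoeff a b q p k
        * baileyKernel (a ^ 2) (a * b * q) (q ^ 2) (p ^ 2) j (2 * k)
      = (-(b * q / a)) ^ j * (ellFac (a / (b * q)) (q ^ 2) (p ^ 2) j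
          * ellFac (a * b * q) (q ^ 2) (p ^ 2) j * ellFac (b ^ 2 * q ^ 4) (q ^ 4) (p ^ 2) j
        / (ellFac (b ^ 2 * q ^ 4) (q ^ 2) (p ^ 2) j * ellFac (q ^ 2) (q ^ 2) (p ^ 2) j
          * ellFac (a ^ 2 * q ^ 2) (q ^ 4) (p ^ 2) j)) := by
  obtain ⟨t, rfl | rfl⟩ := Nat.even_or_odd' j
  · exact sum_quarticCoeff_mul_baileyKernel_even hp ha hb hq hG hj h0
  · exact sum_quarticCoeff_mul_baileyKernel_odd hp ha hb hq hG hj h0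

/-! ### The transformation for generic parameters -/

/-- Both sides of the transformation, written with the kernels in base `q²` and `q`. -/
theorem sum_baileyKernel_eq_sum_quarticCoeff {a b q p : ℂ} (hp : ‖p‖ < 1) (ha : a ≠ 0)
    (hb : b ≠ 0) (hq : q ≠ 0) (hG : IsGenericPair a b q p) (n : ℕ)
    (h0 : ∀ k < n, ellTheta (q ^ 2 * (q ^ 2) ^ k) (p ^ 2) ≠ 0) :
    ∑ j ∈ range (n + 1), ellTheta (a * b * q ^ (4 * j + 1)) (p ^ 2)
        * baileyKernel (a * b * q) (b ^ 2) (q ^ 2) (p ^ 2) n j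
        * (ellFac (-a * q) q p (2 * j) / ellFac (-b * q) q p (2 * j))
        * ((-(b / a)) ^ j * (ellFac (a / (b * q)) (q ^ 2) (p ^ 2) j
          * ellFac (a * b * q) (q ^ 2) (p ^ 2) j * ellFac (b ^ 2 * q ^ 4) (q ^ 4) (p ^ 2) j
          / (ellFac (b ^ 2 * q ^ 4) (q ^ 2) (p ^ 2) j * ellFac (q ^ 2) (q ^ 2) (p ^ 2) j
            * ellFac (a ^ 2 * q ^ 2) (q ^ 4) (p ^ 2) j)))
      = ellTheta (a * b * q) (p ^ 2) * (ellTheta (-b) p / ellTheta (-b * q ^ (2 * n)) p)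
        * q⁻¹ ^ n
        * ∑ k ∈ range (n + 1), quarticCoeff a b q p k * baileyKernel a b q p n (2 * k) := by
  have hp2 : ‖p ^ 2‖ < 1 := by rw [norm_pow]; exact pow_lt_one₀ (norm_nonneg _) hp two_ne_zero
  have hN := fun x => hG.ellTheta_ne_zero ha hb hq hp (Or.inl rfl) (x := x)
  have hN2 := fun x => hG.ellTheta_ne_zero ha hb hq hp (Or.inr rfl) (x := x)
  have hinv := baileyKernel_inversion hp2 (q := q ^ 2) (A := a * b * q) (B := b ^ 2)
    (by positivity) (by positivity) (by positivity) n h0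
    (fun k => hN2 _ 2 0 2 0 (2 + 4 * k) 0 (by ring) (by simp))
    (fun k => hN2 _ 0 0 4 0 (4 * k) 0 (by ring) (by simp))
    (fun m => ellTheta (b * q ^ (2 * m)) p * (a / b) ^ m
      * ∑ k ∈ range (n + 1), quarticCoeff a b q p k * baileyKernel a b q p m (2 * k))
  -- the kernel `(b², abq)` sends the right-hand sides to the coefficients of the left-hand side
  have hX : ∀ j ∈ range (n + 1), ∑ m ∈ range (n + 1),
      baileyKernel (b ^ 2) (a * b * q) (q ^ 2) (p ^ 2) j m
        * (ellTheta (b * q ^ (2 * m)) p * (a / b) ^ m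
          * ∑ k ∈ range (n + 1), quarticCoeff a b q p k * baileyKernel a b q p m (2 * k))
      = ellTheta b p * (a / b) ^ j * (ellFac (-a * q) q p (2 * j) / ellFac (-b * q) q p (2 * j))
        * ((-(b * q / a)) ^ j * (ellFac (a / (b * q)) (q ^ 2) (p ^ 2) j
          * ellFac (a * b * q) (q ^ 2) (p ^ 2) j * ellFac (b ^ 2 * q ^ 4) (q ^ 4) (p ^ 2) j
        / (ellFac (b ^ 2 * q ^ 4) (q ^ 2) (p ^ 2) j * ellFac (q ^ 2) (q ^ 2) (p ^ 2) j
          * ellFac (a ^ 2 * q ^ 2) (q ^ 4) (p ^ 2) j))) := by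
    intro j hj
    have hj := mem_range.1 hj
    rw [← sum_quarticCoeff_mul_baileyKernel hp ha hb hq hG hj (fun k hk => h0 k (by omega)),
      mul_sum]
    simp only [mul_sum]
    rw [sum_comm]
    refine sum_congr rfl fun k _ => ?_
    have h := sum_baileyKernel_sq_mul_baileyKernel hp ha hb hq hG hj
      (fun k hk => h0 k (by omega)) (2 * k)
    calc _ = quarticCoeff a b q p k * ∑ m ∈ range (n + 1),
          baileyKernel (b ^ 2) (a * b * q) (q ^ 2) (p ^ 2) j m
          * (ellTheta (b * q ^ (2 * m)) p * (a / b) ^ m * baileyKernel a b q p m (2 * k)) := by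
          rw [mul_sum]; exact sum_congr rfl fun m _ => by ring
      _ = _ := by rw [h]; ring
  have hb1 : ellTheta b p ≠ 0 := hN _ 0 0 2 0 0 0 (by ring) (by simp)
  have hb2 : ellTheta (b * q ^ (2 * n)) p ≠ 0 := hN _ 0 0 2 0 (4 * n) 0 (by ring) (by simp)
  refine mul_left_cancel₀ hb1 ?_
  rw [sum_congr rfl fun j hj => by rw [hX j hj], ellTheta_sq b hp,
    show b ^ 2 * (q ^ 2) ^ (2 * n) = (b * q ^ (2 * n)) ^ 2 by ring, ellTheta_sq _ hp] at hinv
  rw [mul_sum]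
  refine Eq.trans (sum_congr rfl fun j _ => ?_) (hinv.trans ?_)
  · have e1 : (-(b / a)) ^ j = (b ^ 2 / (a * b * q)) ^ j * (a / b) ^ j * (-(b * q / a)) ^ j := by
      rw [← mul_pow, ← mul_pow]; congr 1; field_simp
    rw [e1, show a * b * q * (q ^ 2) ^ (2 * j) = a * b * q ^ (4 * j + 1) by ring]
    ring
  · have e1 : q⁻¹ ^ n = (b ^ 2 / (a * b * q)) ^ n * (a / b) ^ n := by
      rw [← mul_pow]; congr 1; field_simp
    rw [e1, neg_mul]
    refine eq_of_eq_mul_mul_inv hb2 ?_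
    ring

/-- The quotient of two kernels in the form in which it enters terminating series. -/
theorem baileyKernel_eq_mul_ellFac {A B q p : ℂ} (hp : ‖p‖ < 1) (hA : A ≠ 0) (hB : B ≠ 0)
    (hq : q ≠ 0) {n j : ℕ} (hj : j ≤ n) (h1 : ellFac q q p n ≠ 0) (h2 : ellFac (B / A) q p n ≠ 0) :
    baileyKernel A B q p n j * (B / (A * q)) ^ j
      = baileyKernel A B q p n 0 * (ellFac (B * q ^ n) q p j * ellFac ((q ^ n)⁻¹) q p j
        / (ellFac (A * q / (B * q ^ n)) q p j * ellFac (A * q ^ (1 + n)) q p j)) := by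
  obtain ⟨e, rfl⟩ : ∃ e, n = j + e := ⟨n - j, by omega⟩
  have hr := ellFac_reverse_div hp (y := B / A) (z := q) (by positivity) hq hq j e h2 h1
  rw [show (q * q ^ (j + e))⁻¹ * q = (q ^ (j + e))⁻¹ by field_simp,
    show (B / A * q ^ (j + e))⁻¹ * q = A * q / (B * q ^ (j + e)) by field_simp,
    show B / A / q = B / (A * q) by field_simp] at hr
  rw [baileyKernel_of_le hj, baileyKernel_of_le (by omega), ellFac_add B, ellFac_add (A * q),
    show A * q * q ^ (j + e) = A * q ^ (1 + (j + e)) by ring, add_zero, Nat.sub_zero,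
    show j + e - j = e by omega]
  calc _ = ellFac B q p (j + e) * ellFac (B * q ^ (j + e)) q p j * ellFac (B / A) q p (j + e)
        / (ellFac (A * q) q p (j + e) * ellFac (A * q ^ (1 + (j + e))) q p j * ellFac q q p (j + e))
        * (ellFac q q p (j + e) * ellFac (B / A) q p e /
        (ellFac (B / A) q p (j + e) * ellFac q q p e) * (B / (A * q)) ^ j) := by
        refine (eq_of_eq_mul_mul_inv h1 (eq_of_eq_mul_mul_inv h2 ?_)).symm
        ring
    _ = _ := by rw [← hr]; ring

/-- The left-hand side of the transformation. -/
noncomputable def transformationLeft (n : ℕ) (a b q p : ℂ) : ℂ :=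
  ∑ j ∈ Finset.range (n + 1),
      (ellTheta (a * b * q ^ (4 * j + 1)) (p ^ 2)
        * ellFacs [b ^ 2 * q ^ (2 * n), q ^ (-2 * (n : ℤ)), a / (b * q), a * b * q]
            (q ^ 2) (p ^ 2) j
        * ellFac (-a * q) q p (2 * j)
        * ellFac (b ^ 2 * q ^ 4) (q ^ 4) (p ^ 2) j)
      / (ellTheta (a * b * q) (p ^ 2)
        * ellFacs [a * q ^ (3 - 2 * (n : ℤ)) / b, a * b * q ^ (3 + 2 * n), b ^ 2 * q ^ 4, q ^ 2]
            (q ^ 2) (p ^ 2) j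
        * ellFac (-b * q) q p (2 * j)
        * ellFac (a ^ 2 * q ^ 2) (q ^ 4) (p ^ 2) j)
      * (-1) ^ j * q ^ (3 * j)

/-- The right-hand side of the transformation. -/
noncomputable def transformationRight (n : ℕ) (a b q p : ℂ) : ℂ :=
  (ellTheta (-b) p * ellFacs [-q, b / a] q p n * ellFac (a * b * q ^ 3) (q ^ 2) (p ^ 2) n)
      / (ellTheta (-b * q ^ (2 * n)) p * ellFacs [-b, a * q] q p n
        * ellFac (b / (a * q)) (q ^ 2) (p ^ 2) n)
      * q ^ (-(n : ℤ))
      * ∑ k ∈ Finset.range (n + 1),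
        (ellTheta (a ^ 2 * q ^ (8 * k)) (p ^ 2)
          * ellFacs [b * q ^ n, q ^ (-(n : ℤ))] q p (2 * k)
          * ellFacs [a ^ 2, a ^ 2 / (b ^ 2 * q ^ 2)] (q ^ 4) (p ^ 2) k)
        / (ellTheta (a ^ 2) (p ^ 2)
          * ellFacs [a * q ^ (1 - (n : ℤ)) / b, a * q ^ (1 + n)] q p (2 * k)
          * ellFacs [q ^ 4, b ^ 2 * q ^ 6] (q ^ 4) (p ^ 2) k)
        * q ^ (4 * k)

/-- A series with the factor `(q^{-n}; q, p)_k` terminates. -/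
theorem ellFac_zpow_neg_eq_zero {q p : ℂ} (hq : q ≠ 0) {n k : ℕ} (h : n < k) :
    ellFac (q ^ (-(n : ℤ))) q p k = 0 := by
  refine prod_eq_zero (mem_range.2 h) ?_
  rw [zpow_neg, zpow_natCast, inv_mul_cancel₀ (pow_ne_zero n hq), ellTheta_one]

/-- The transformation for generic parameters: `sum_baileyKernel_eq_sum_quarticCoeff` with the
kernels normalized by their first columns. -/
theorem transformation_of_isGenericPair {a b q p : ℂ} (hp : ‖p‖ < 1) (ha : a ≠ 0)
    (hb : b ≠ 0) (hq : q ≠ 0) (hG : IsGenericPair a b q p) (n : ℕ)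
    (h0 : ∀ k < n, ellTheta (q ^ 2 * (q ^ 2) ^ k) (p ^ 2) ≠ 0) :
    transformationLeft n a b q p = transformationRight n a b q p := by
  have hp2 : ‖p ^ 2‖ < 1 := by rw [norm_pow]; exact pow_lt_one₀ (norm_nonneg _) hp two_ne_zero
  have hN := fun x => hG.ellTheta_ne_zero ha hb hq hp (Or.inl rfl) (x := x)
  have hN2 := fun x => hG.ellTheta_ne_zero ha hb hq hp (Or.inr rfl) (x := x)
  have hmain := sum_baileyKernel_eq_sum_quarticCoeff hp ha hb hq hG n h0
  have hq2 : ellFac (q ^ 2) (q ^ 2) (p ^ 2) n ≠ 0 := ellFac_ne_zero h0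
  have hq1 := hq2
  rw [ellFac_sq q q hp] at hq1
  have f1 : ellFac q q p n ≠ 0 := left_ne_zero_of_mul hq1
  have f2 : ellFac (-q) q p n ≠ 0 := right_ne_zero_of_mul hq1
  have f3 : ellFac (b / a) q p n ≠ 0 := ellFac_ne_zero fun k _ =>
    hN _ 0 2 2 0 (2 * k) 0 (by field_simp; ring) (by simp)
  have f4 : ellFac b q p n ≠ 0 := ellFac_ne_zero fun k _ =>
    hN _ 0 0 2 0 (2 * k) 0 (by ring) (by simp)
  have f5 : ellFac (-b) q p n ≠ 0 := ellFac_ne_zero fun k _ =>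
    hN _ 0 0 2 0 (2 * k) 0 (by ring) (by simp)
  have f6 : ellFac (a * q) q p n ≠ 0 := ellFac_ne_zero fun k _ =>
    hN _ 2 0 0 0 (2 + 2 * k) 0 (by ring) (by simp)
  have f7 : ellFac (a * b * q ^ 3) (q ^ 2) (p ^ 2) n ≠ 0 := ellFac_ne_zero fun k _ =>
    hN2 _ 2 0 2 0 (6 + 4 * k) 0 (by ring) (by simp)
  have f8 : ellFac (b / (a * q)) (q ^ 2) (p ^ 2) n ≠ 0 := ellFac_ne_zero fun k _ =>
    hN2 _ 0 2 2 0 (4 * k) 2 (by field_simp; ring) (by simp)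
  have f9 : ellTheta (a * b * q) (p ^ 2) ≠ 0 := hN2 _ 2 0 2 0 2 0 (by ring) (by simp)
  have hBA : b ^ 2 / (a * b * q) = b / (a * q) := by field_simp
  -- the kernels in the first column
  have hK2 : baileyKernel (a * b * q) (b ^ 2) (q ^ 2) (p ^ 2) n 0
      = ellFac b q p n * ellFac (-b) q p n * ellFac (b / (a * q)) (q ^ 2) (p ^ 2) n
        / (ellFac (a * b * q ^ 3) (q ^ 2) (p ^ 2) n * (ellFac q q p n * ellFac (-q) q p n)) := by
    rw [baileyKernel_of_le (Nat.zero_le n), hBA, show a * b * q * q ^ 2 = a * b * q ^ 3 by ring,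
      add_zero, Nat.sub_zero, ellFac_sq b q hp, ellFac_sq q q hp]
  have hK1 : baileyKernel a b q p n 0
      = ellFac b q p n * ellFac (b / a) q p n / (ellFac (a * q) q p n * ellFac q q p n) := by
    rw [baileyKernel_of_le (Nat.zero_le n), add_zero, Nat.sub_zero]
  have hK2' : baileyKernel (a * b * q) (b ^ 2) (q ^ 2) (p ^ 2) n 0 ≠ 0 := by
    rw [hK2]; positivity
  have hpre : (ellTheta (-b) p * ellFacs [-q, b / a] q p n
        * ellFac (a * b * q ^ 3) (q ^ 2) (p ^ 2) n)
      / (ellTheta (-b * q ^ (2 * n)) p * ellFacs [-b, a * q] q p n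
        * ellFac (b / (a * q)) (q ^ 2) (p ^ 2) n) * q ^ (-(n : ℤ))
      = ellTheta (-b) p / ellTheta (-b * q ^ (2 * n)) p * q⁻¹ ^ n * baileyKernel a b q p n 0
        / baileyKernel (a * b * q) (b ^ 2) (q ^ 2) (p ^ 2) n 0 := by
    rw [hK1, hK2, zpow_neg, zpow_natCast, inv_pow]
    simp only [ellFacs, List.map_cons, List.map_nil, List.prod_cons, List.prod_nil, mul_one]
    generalize ellFac q q p n = x1 at *
    generalize ellFac (-q) q p n = x2 at *
    generalize ellFac (b / a) q p n = x3 at *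
    generalize ellFac b q p n = x4 at *
    generalize ellFac (-b) q p n = x5 at *
    generalize ellFac (a * q) q p n = x6 at *
    generalize ellFac (a * b * q ^ 3) (q ^ 2) (p ^ 2) n = x7 at *
    generalize ellFac (b / (a * q)) (q ^ 2) (p ^ 2) n = x8 at *
    generalize ellTheta (-b * q ^ (2 * n)) p = x9 at *
    generalize ellTheta (-b) p = x10 at *
    field_simp
  have hleft : transformationLeft n a b q p * (ellTheta (a * b * q) (p ^ 2)
      * baileyKernel (a * b * q) (b ^ 2) (q ^ 2) (p ^ 2) n 0)
      = ∑ j ∈ range (n + 1), ellTheta (a * b * q ^ (4 * j + 1)) (p ^ 2)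
        * baileyKernel (a * b * q) (b ^ 2) (q ^ 2) (p ^ 2) n j
        * (ellFac (-a * q) q p (2 * j) / ellFac (-b * q) q p (2 * j))
        * ((-(b / a)) ^ j * (ellFac (a / (b * q)) (q ^ 2) (p ^ 2) j
          * ellFac (a * b * q) (q ^ 2) (p ^ 2) j * ellFac (b ^ 2 * q ^ 4) (q ^ 4) (p ^ 2) j
          / (ellFac (b ^ 2 * q ^ 4) (q ^ 2) (p ^ 2) j * ellFac (q ^ 2) (q ^ 2) (p ^ 2) j
            * ellFac (a ^ 2 * q ^ 2) (q ^ 4) (p ^ 2) j))) := by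
    rw [transformationLeft, sum_mul]
    refine sum_congr rfl fun j hj => ?_
    have hk := baileyKernel_eq_mul_ellFac hp2 (A := a * b * q) (B := b ^ 2) (q := q ^ 2)
      (by positivity) (by positivity) (by positivity) (Nat.le_of_lt_succ (mem_range.1 hj)) hq2
      (by rwa [hBA])
    rw [show b ^ 2 * (q ^ 2) ^ n = b ^ 2 * q ^ (2 * n) by ring,
      show ((q ^ 2) ^ n)⁻¹ = q ^ (-2 * (n : ℤ)) by
        rw [neg_mul, zpow_neg, ← pow_mul]; norm_cast,
      show a * b * q * q ^ 2 / (b ^ 2 * q ^ (2 * n)) = a * q ^ (3 - 2 * (n : ℤ)) / b by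
        rw [show q ^ (3 - 2 * (n : ℤ)) = q ^ 3 / q ^ (2 * n) by rw [zpow_sub₀ hq]; norm_cast]
        field_simp,
      show a * b * q * (q ^ 2) ^ (1 + n) = a * b * q ^ (3 + 2 * n) by ring] at hk
    have e1 : (-(b / a)) ^ j = (b ^ 2 / (a * b * q * q ^ 2)) ^ j * ((-1) ^ j * q ^ (3 * j)) := by
      rw [pow_mul, ← mul_pow, ← mul_pow]; congr 1; field_simp
    simp only [ellFacs, List.map_cons, List.map_nil, List.prod_cons, List.prod_nil, mul_one]
    calc _ = ellTheta (a * b * q ^ (4 * j + 1)) (p ^ 2)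
        * (baileyKernel (a * b * q) (b ^ 2) (q ^ 2) (p ^ 2) n 0
          * (ellFac (b ^ 2 * q ^ (2 * n)) (q ^ 2) (p ^ 2) j
            * ellFac (q ^ (-2 * (n : ℤ))) (q ^ 2) (p ^ 2) j
            / (ellFac (a * q ^ (3 - 2 * (n : ℤ)) / b) (q ^ 2) (p ^ 2) j
              * ellFac (a * b * q ^ (3 + 2 * n)) (q ^ 2) (p ^ 2) j)))
        * (ellFac (-a * q) q p (2 * j) / ellFac (-b * q) q p (2 * j))
        * ((-1) ^ j * q ^ (3 * j) * (ellFac (a / (b * q)) (q ^ 2) (p ^ 2) j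
          * ellFac (a * b * q) (q ^ 2) (p ^ 2) j * ellFac (b ^ 2 * q ^ 4) (q ^ 4) (p ^ 2) j
          / (ellFac (b ^ 2 * q ^ 4) (q ^ 2) (p ^ 2) j * ellFac (q ^ 2) (q ^ 2) (p ^ 2) j
            * ellFac (a ^ 2 * q ^ 2) (q ^ 4) (p ^ 2) j))) := by
          refine eq_of_eq_mul_mul_inv f9 ?_
          ring
      _ = _ := by
          rw [← hk, e1]
          ring
  have hright : ∑ k ∈ range (n + 1), quarticCoeff a b q p k * baileyKernel a b q p n (2 * k)
      = baileyKernel a b q p n 0 * ∑ k ∈ Finset.range (n + 1),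
        (ellTheta (a ^ 2 * q ^ (8 * k)) (p ^ 2)
          * ellFacs [b * q ^ n, q ^ (-(n : ℤ))] q p (2 * k)
          * ellFacs [a ^ 2, a ^ 2 / (b ^ 2 * q ^ 2)] (q ^ 4) (p ^ 2) k)
        / (ellTheta (a ^ 2) (p ^ 2)
          * ellFacs [a * q ^ (1 - (n : ℤ)) / b, a * q ^ (1 + n)] q p (2 * k)
          * ellFacs [q ^ 4, b ^ 2 * q ^ 6] (q ^ 4) (p ^ 2) k)
        * q ^ (4 * k) := by
    rw [mul_sum]
    refine sum_congr rfl fun k _ => ?_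
    simp only [ellFacs, List.map_cons, List.map_nil, List.prod_cons, List.prod_nil, mul_one]
    rcases lt_or_ge n (2 * k) with hk | hk
    · rw [baileyKernel_of_lt hk, ellFac_zpow_neg_eq_zero hq hk]
      ring
    · have hk := baileyKernel_eq_mul_ellFac hp ha hb hq hk f1 f3
      rw [show (q ^ n)⁻¹ = q ^ (-(n : ℤ)) by rw [zpow_neg, zpow_natCast],
        show a * q / (b * q ^ n) = a * q ^ (1 - (n : ℤ)) / b by
          rw [zpow_sub₀ hq]; field_simp; norm_cast] at hk
      have e1 : (a ^ 2 / (b ^ 2 * q ^ 2))⁻¹ ^ k = (b / (a * q)) ^ (2 * k) * q ^ (4 * k) := by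
        rw [pow_mul, pow_mul q, ← mul_pow ((b / (a * q)) ^ 2)]; congr 1; field_simp
      rw [quarticCoeff, e1]
      linear_combination (ellTheta (a ^ 2 * q ^ (8 * k)) (p ^ 2) / ellTheta (a ^ 2) (p ^ 2)
        * (ellFac (a ^ 2) (q ^ 4) (p ^ 2) k * ellFac (a ^ 2 / (b ^ 2 * q ^ 2)) (q ^ 4) (p ^ 2) k
        / (ellFac (q ^ 4) (q ^ 4) (p ^ 2) k * ellFac (b ^ 2 * q ^ 6) (q ^ 4) (p ^ 2) k))
        * q ^ (4 * k)) * hk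
  rw [hright] at hmain
  refine mul_right_cancel₀ (mul_ne_zero f9 hK2') ?_
  rw [hleft, hmain, transformationRight, hpre]
  generalize baileyKernel (a * b * q) (b ^ 2) (q ^ 2) (p ^ 2) n 0 = K at *
  refine eq_of_eq_mul_mul_inv hK2' ?_ |>.symm
  ring

/-! ### Density of the generic parameters and continuity -/

theorem countable_setOf_zpow_mul_eq {i : ℤ} (hi : i ≠ 0) {u v : ℂ} (hu : u ≠ 0) :
    {x : ℂ | x ^ i * u = v}.Countable := by
  have hfin (w : ℂ) : {x : ℂ | x ^ i.natAbs = w}.Countable := by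
    refine ((Polynomial.nthRoots i.natAbs w).toFinset.finite_toSet.subset fun x hx => ?_).countable
    simpa [Polynomial.mem_nthRoots (Int.natAbs_pos.2 hi)] using hx
  refine ((hfin (v / u)).union (hfin (v / u)⁻¹)).mono fun x hx => ?_
  have hx : x ^ i = v / u := eq_div_of_mul_eq hu hx
  rcases Int.natAbs_eq i with h | h
  · left
    rw [h, zpow_natCast] at hx
    exact hx
  · right
    rw [h, zpow_neg, zpow_natCast] at hx
    simp only [Set.mem_ofPred_eq]
    rw [← hx, inv_inv]

/-- Generic pairs are dense: all but countably many `b` are independent of `q` and `p`, and for such a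
`b` all but countably many `a` are independent of `b`, `q` and `p`. -/
theorem dense_isGenericPair {q : ℂ} (hq : q ≠ 0) (p : ℂ) :
    Dense {z : ℂ × ℂ | z.1 ≠ 0 ∧ z.2 ≠ 0 ∧ IsGenericPair z.1 z.2 q p} := by
  have hB : Dense ({b : ℂ | b = 0} ∪ ⋃ (j : ℤ) (k : ℤ) (m : ℤ) (_ : j ≠ 0),
      {b : ℂ | b ^ j * q ^ k = p ^ m})ᶜ := by
    refine Set.Countable.dense_compl ℂ ?_
    refine (Set.countable_singleton (0 : ℂ)).union ?_
    refine Set.countable_iUnion fun j => Set.countable_iUnion fun k => Set.countable_iUnion fun m =>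
      Set.countable_iUnion fun hj => countable_setOf_zpow_mul_eq hj (zpow_ne_zero _ hq)
  rw [Metric.dense_iff]
  rintro ⟨a₀, b₀⟩ r hr
  obtain ⟨b, hb, hb'⟩ := Metric.dense_iff.1 hB b₀ r hr
  simp only [Set.mem_compl_iff, Set.mem_union, Set.mem_ofPred_eq, Set.mem_iUnion, not_or,
    not_exists] at hb'
  obtain ⟨hb0, hb'⟩ := hb'
  have hA : Dense ({a : ℂ | a = 0} ∪ ⋃ (i : ℤ) (j : ℤ) (k : ℤ) (m : ℤ) (_ : i ≠ 0),
      {a : ℂ | a ^ i * (b ^ j * q ^ k) = p ^ m})ᶜ := by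
    refine Set.Countable.dense_compl ℂ ?_
    refine (Set.countable_singleton (0 : ℂ)).union ?_
    refine Set.countable_iUnion fun i => Set.countable_iUnion fun j => Set.countable_iUnion fun k =>
      Set.countable_iUnion fun m => Set.countable_iUnion fun hi =>
        countable_setOf_zpow_mul_eq hi (mul_ne_zero (zpow_ne_zero _ hb0) (zpow_ne_zero _ hq))
  obtain ⟨a, ha, ha'⟩ := Metric.dense_iff.1 hA a₀ r hr
  simp only [Set.mem_compl_iff, Set.mem_union, Set.mem_ofPred_eq, Set.mem_iUnion, not_or,
    not_exists] at ha'
  obtain ⟨ha0, ha'⟩ := ha'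
  refine ⟨(a, b), ?_, ha0, hb0, fun i j k m hij h => ?_⟩
  · rw [Metric.mem_ball, Prod.dist_eq]
    exact max_lt ha hb
  · by_cases hi : i = 0
    · subst hi
      exact hb' j k m (by simpa using hij) (by simpa using h)
    · exact ha' i j k m hi (by rw [← h]; ring)

theorem ContinuousAt.ellTheta {X : Type*} [TopologicalSpace X] {f : X → ℂ} {x : X} {p : ℂ}
    (hp : ‖p‖ < 1) (hf : ContinuousAt f x) (h0 : f x ≠ 0) :
    ContinuousAt (fun y => ellTheta (f y) p) x :=
  ContinuousAt.comp (f := f) (g := fun z => _root_.ellTheta z p) (continuousAt_ellTheta h0 hp) hf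

theorem ContinuousAt.ellFac {X : Type*} [TopologicalSpace X] {f : X → ℂ} {x : X} {q p : ℂ}
    (hp : ‖p‖ < 1) (hq : q ≠ 0) (hf : ContinuousAt f x) (h0 : f x ≠ 0) (k : ℕ) :
    ContinuousAt (fun y => ellFac (f y) q p k) x := by
  unfold _root_.ellFac
  exact tendsto_finsetProd _ fun i _ => ContinuousAt.ellTheta hp (hf.mul continuousAt_const)
    (mul_ne_zero h0 (pow_ne_zero i hq))

theorem ContinuousAt.ellFacs_pair {X : Type*} [TopologicalSpace X] {f g : X → ℂ} {x : X} {q p : ℂ}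
    (hp : ‖p‖ < 1) (hq : q ≠ 0) (hf : ContinuousAt f x) (hf0 : f x ≠ 0) (hg : ContinuousAt g x)
    (hg0 : g x ≠ 0) (k : ℕ) : ContinuousAt (fun y => ellFacs [f y, g y] q p k) x := by
  simp only [ellFacs, List.map_cons, List.map_nil, List.prod_cons, List.prod_nil, mul_one]
  exact (ContinuousAt.ellFac hp hq hf hf0 k).mul (ContinuousAt.ellFac hp hq hg hg0 k)

theorem ContinuousAt.ellFacs_quadruple {X : Type*} [TopologicalSpace X] {f g h u : X → ℂ} {x : X}
    {q p : ℂ} (hp : ‖p‖ < 1) (hq : q ≠ 0) (hf : ContinuousAt f x) (hf0 : f x ≠ 0)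
    (hg : ContinuousAt g x) (hg0 : g x ≠ 0) (hh : ContinuousAt h x) (hh0 : h x ≠ 0)
    (hu : ContinuousAt u x) (hu0 : u x ≠ 0) (k : ℕ) :
    ContinuousAt (fun y => ellFacs [f y, g y, h y, u y] q p k) x := by
  simp only [ellFacs, List.map_cons, List.map_nil, List.prod_cons, List.prod_nil, mul_one]
  exact (ContinuousAt.ellFac hp hq hf hf0 k).mul ((ContinuousAt.ellFac hp hq hg hg0 k).mul
    ((ContinuousAt.ellFac hp hq hh hh0 k).mul (ContinuousAt.ellFac hp hq hu hu0 k)))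

theorem continuousAt_transformationLeft (n : ℕ) {a b q p : ℂ} (ha : a ≠ 0) (hb : b ≠ 0)
    (hq : q ≠ 0) (hp : ‖p‖ < 1)
    (hL : ∀ j : ℕ, j ≤ n →
      ellTheta (a * b * q) (p ^ 2)
        * ellFacs [a * q ^ (3 - 2 * (n : ℤ)) / b, a * b * q ^ (3 + 2 * n), b ^ 2 * q ^ 4, q ^ 2]
            (q ^ 2) (p ^ 2) j
        * ellFac (-b * q) q p (2 * j)
        * ellFac (a ^ 2 * q ^ 2) (q ^ 4) (p ^ 2) j ≠ 0) :
    ContinuousAt (fun z : ℂ × ℂ => transformationLeft n z.1 z.2 q p) (a, b) := by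
  have hp2 : ‖p ^ 2‖ < 1 := by rw [norm_pow]; exact pow_lt_one₀ (norm_nonneg _) hp two_ne_zero
  have h1 : ContinuousAt (fun z : ℂ × ℂ => z.1) (a, b) := continuousAt_fst
  have h2 : ContinuousAt (fun z : ℂ × ℂ => z.2) (a, b) := continuousAt_snd
  have hq2 : q ^ 2 ≠ 0 := pow_ne_zero 2 hq
  have hq4 : q ^ 4 ≠ 0 := pow_ne_zero 4 hq
  have hz (m : ℤ) : q ^ m ≠ 0 := zpow_ne_zero m hq
  unfold transformationLeft
  refine tendsto_finsetSum _ fun j hj => ?_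
  have hj := Nat.le_of_lt_succ (mem_range.1 hj)
  refine ContinuousAt.mul (ContinuousAt.mul (ContinuousAt.div ?_ ?_ (hL j hj))
    continuousAt_const) continuousAt_const
  · refine ContinuousAt.mul (ContinuousAt.mul (ContinuousAt.mul ?_ ?_) ?_) ?_
    · exact ContinuousAt.ellTheta hp2 (by fun_prop) (by simp [ha, hb, hq])
    · exact ContinuousAt.ellFacs_quadruple hp2 hq2 (by fun_prop) (by simp [hb, hq]) (by fun_prop)
        (by exact zpow_ne_zero _ hq) (h1.div (by fun_prop) (by simp [hb, hq])) (by simp [ha, hb, hq])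
        (by fun_prop) (by simp [ha, hb, hq]) j
    · exact ContinuousAt.ellFac hp hq (by fun_prop) (by simp [ha, hq]) _
    · exact ContinuousAt.ellFac hp2 hq4 (by fun_prop) (by simp [hb, hq]) _
  · refine ContinuousAt.mul (ContinuousAt.mul (ContinuousAt.mul ?_ ?_) ?_) ?_
    · exact ContinuousAt.ellTheta hp2 (by fun_prop) (by simp [ha, hb, hq])
    · exact ContinuousAt.ellFacs_quadruple hp2 hq2 ((h1.mul continuousAt_const).div h2 hb)
        (div_ne_zero (mul_ne_zero ha (hz _)) hb) (by fun_prop) (by simp [ha, hb, hq])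
        (by fun_prop) (by simp [hb, hq]) (by fun_prop) (by simp [hq]) j
    · exact ContinuousAt.ellFac hp hq (by fun_prop) (by simp [hb, hq]) _
    · exact ContinuousAt.ellFac hp2 hq4 (by fun_prop) (by simp [ha, hq]) _

theorem continuousAt_transformationRight (n : ℕ) {a b q p : ℂ} (ha : a ≠ 0) (hb : b ≠ 0)
    (hq : q ≠ 0) (hp : ‖p‖ < 1)
    (hC : ellTheta (-b * q ^ (2 * n)) p * ellFacs [-b, a * q] q p n
        * ellFac (b / (a * q)) (q ^ 2) (p ^ 2) n ≠ 0)
    (hR : ∀ k : ℕ, 2 * k ≤ n →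
      ellTheta (a ^ 2) (p ^ 2)
        * ellFacs [a * q ^ (1 - (n : ℤ)) / b, a * q ^ (1 + n)] q p (2 * k)
        * ellFacs [q ^ 4, b ^ 2 * q ^ 6] (q ^ 4) (p ^ 2) k ≠ 0) :
    ContinuousAt (fun z : ℂ × ℂ => transformationRight n z.1 z.2 q p) (a, b) := by
  have hp2 : ‖p ^ 2‖ < 1 := by rw [norm_pow]; exact pow_lt_one₀ (norm_nonneg _) hp two_ne_zero
  have h1 : ContinuousAt (fun z : ℂ × ℂ => z.1) (a, b) := continuousAt_fst
  have h2 : ContinuousAt (fun z : ℂ × ℂ => z.2) (a, b) := continuousAt_snd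
  have hq2 : q ^ 2 ≠ 0 := pow_ne_zero 2 hq
  have hq4 : q ^ 4 ≠ 0 := pow_ne_zero 4 hq
  have hz (m : ℤ) : q ^ m ≠ 0 := zpow_ne_zero m hq
  unfold transformationRight
  refine ContinuousAt.mul (ContinuousAt.mul (ContinuousAt.div ?_ ?_ hC) continuousAt_const)
    (tendsto_finsetSum _ fun k _ => ?_)
  · refine ContinuousAt.mul (ContinuousAt.mul ?_ ?_) ?_
    · exact ContinuousAt.ellTheta hp (by fun_prop) (by simp [hb])
    · exact ContinuousAt.ellFacs_pair hp hq (by fun_prop) (by simp [hq]) (h2.div h1 ha)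
        (div_ne_zero hb ha) n
    · exact ContinuousAt.ellFac hp2 hq2 (by fun_prop) (by simp [ha, hb, hq]) n
  · refine ContinuousAt.mul (ContinuousAt.mul ?_ ?_) ?_
    · exact ContinuousAt.ellTheta hp (by fun_prop) (by simp [hb, hq])
    · exact ContinuousAt.ellFacs_pair hp hq (by fun_prop) (by simp [hb]) (by fun_prop)
        (by simp [ha, hq]) n
    · exact ContinuousAt.ellFac hp2 hq2 (h2.div (by fun_prop) (by simp [ha, hq]))
        (by simp [ha, hb, hq]) n
  · rcases lt_or_ge n (2 * k) with hk | hk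
    · -- past its termination the series is identically zero, whatever the denominators are
      simp only [ellFacs, List.map_cons, List.map_nil, List.prod_cons, List.prod_nil, mul_one,
        ellFac_zpow_neg_eq_zero hq hk, mul_zero, zero_mul, zero_div]
      exact continuousAt_const
    · refine ContinuousAt.mul (ContinuousAt.div ?_ ?_ (hR k hk)) continuousAt_const
      · refine ContinuousAt.mul (ContinuousAt.mul ?_ ?_) ?_
        · exact ContinuousAt.ellTheta hp2 (by fun_prop) (by simp [ha, hq])
        · exact ContinuousAt.ellFacs_pair hp hq (by fun_prop) (by simp [hb, hq]) (by fun_prop)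
            (by exact zpow_ne_zero _ hq) _
        · exact ContinuousAt.ellFacs_pair hp2 hq4 (by fun_prop) (by simp [ha])
            (ContinuousAt.div (by fun_prop) (by fun_prop) (by simp [hb, hq]))
            (by simp [ha, hb, hq]) k
      · refine ContinuousAt.mul (ContinuousAt.mul ?_ ?_) ?_
        · exact ContinuousAt.ellTheta hp2 (by fun_prop) (by simp [ha])
        · exact ContinuousAt.ellFacs_pair hp hq ((h1.mul continuousAt_const).div h2 hb)
            (div_ne_zero (mul_ne_zero ha (hz _)) hb) (by fun_prop) (by simp [ha, hq]) _
        · exact ContinuousAt.ellFacs_pair hp2 hq4 (by fun_prop) (by simp [hq]) (by fun_prop)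
            (by simp [hb, hq]) k

theorem mainTheorem7 (n : ℕ) (a b q p : ℂ)
    (ha : a ≠ 0) (hb : b ≠ 0) (hq : q ≠ 0) (hp : ‖p‖ < 1)
    -- no denominator on the left-hand side vanishes
    (hL : ∀ j : ℕ, j ≤ n →
      ellTheta (a * b * q) (p ^ 2)
        * ellFacs [a * q ^ (3 - 2 * (n : ℤ)) / b, a * b * q ^ (3 + 2 * n), b ^ 2 * q ^ 4, q ^ 2]
            (q ^ 2) (p ^ 2) j
        * ellFac (-b * q) q p (2 * j)
        * ellFac (a ^ 2 * q ^ 2) (q ^ 4) (p ^ 2) j ≠ 0)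
    -- the denominator of the factor in front of the sum on the right-hand side does not vanish
    (hC : ellTheta (-b * q ^ (2 * n)) p * ellFacs [-b, a * q] q p n
        * ellFac (b / (a * q)) (q ^ 2) (p ^ 2) n ≠ 0)
    -- no denominator vanishes in the sum on the right-hand side, before it terminates
    (hR : ∀ k : ℕ, 2 * k ≤ n →
      ellTheta (a ^ 2) (p ^ 2)
        * ellFacs [a * q ^ (1 - (n : ℤ)) / b, a * q ^ (1 + n)] q p (2 * k)
        * ellFacs [q ^ 4, b ^ 2 * q ^ 6] (q ^ 4) (p ^ 2) k ≠ 0) :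
    ∑ j ∈ Finset.range (n + 1),
      (ellTheta (a * b * q ^ (4 * j + 1)) (p ^ 2)
        * ellFacs [b ^ 2 * q ^ (2 * n), q ^ (-2 * (n : ℤ)), a / (b * q), a * b * q]
            (q ^ 2) (p ^ 2) j
        * ellFac (-a * q) q p (2 * j)
        * ellFac (b ^ 2 * q ^ 4) (q ^ 4) (p ^ 2) j)
      / (ellTheta (a * b * q) (p ^ 2)
        * ellFacs [a * q ^ (3 - 2 * (n : ℤ)) / b, a * b * q ^ (3 + 2 * n), b ^ 2 * q ^ 4, q ^ 2]
            (q ^ 2) (p ^ 2) j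
        * ellFac (-b * q) q p (2 * j)
        * ellFac (a ^ 2 * q ^ 2) (q ^ 4) (p ^ 2) j)
      * (-1) ^ j * q ^ (3 * j)
    = (ellTheta (-b) p * ellFacs [-q, b / a] q p n * ellFac (a * b * q ^ 3) (q ^ 2) (p ^ 2) n)
      / (ellTheta (-b * q ^ (2 * n)) p * ellFacs [-b, a * q] q p n
        * ellFac (b / (a * q)) (q ^ 2) (p ^ 2) n)
      * q ^ (-(n : ℤ))
      * ∑ k ∈ Finset.range (n + 1),
        (ellTheta (a ^ 2 * q ^ (8 * k)) (p ^ 2)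
          * ellFacs [b * q ^ n, q ^ (-(n : ℤ))] q p (2 * k)
          * ellFacs [a ^ 2, a ^ 2 / (b ^ 2 * q ^ 2)] (q ^ 4) (p ^ 2) k)
        / (ellTheta (a ^ 2) (p ^ 2)
          * ellFacs [a * q ^ (1 - (n : ℤ)) / b, a * q ^ (1 + n)] q p (2 * k)
          * ellFacs [q ^ 4, b ^ 2 * q ^ 6] (q ^ 4) (p ^ 2) k)
        * q ^ (4 * k) := by
  -- the only condition on `q` alone is the factor `(q²; q², p²)_n` of the last denominator
  have h0 : ∀ k < n, ellTheta (q ^ 2 * (q ^ 2) ^ k) (p ^ 2) ≠ 0 := by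
    have h := hL n le_rfl
    simp only [ellFacs, List.map_cons, List.map_nil, List.prod_cons, List.prod_nil, mul_one] at h
    have h := right_ne_zero_of_mul (right_ne_zero_of_mul (right_ne_zero_of_mul
      (right_ne_zero_of_mul (left_ne_zero_of_mul (left_ne_zero_of_mul h)))))
    exact fun k hk => prod_ne_zero_iff.1 h k (mem_range.2 hk)
  change transformationLeft n a b q p = transformationRight n a b q p
  by_contra hne
  have hcont := (continuousAt_transformationLeft n ha hb hq hp hL).sub
    (continuousAt_transformationRight n ha hb hq hp hC hR)
  obtain ⟨z, hz, hz1, hz2, hzG⟩ := mem_closure_iff_nhds.1 (dense_isGenericPair hq p (a, b)) _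
    (hcont.eventually_ne (sub_ne_zero.2 hne))
  exact hz (sub_eq_zero.2 (transformation_of_isGenericPair hp hz1 hz2 hq hzG n h0))
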